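/- For $m\in\mathbb{N}=\{1,2,\dots\}$ let $$\kappa_{2m}=\frac{2(3m-2)(3m-1)^2}{27(2m-1)},\quad \kappa_{2m-1}=\frac{2(3m-1)(3m-2)^2}{27(2m-1)},\quad \nu_{2m}=\frac{2(3m-2)^3}{27(2m-1)},\quad \nu_{2m-1}=\frac{2(3m-1)^3}{27(2m-1)}.$$ Let $x$ be a complex number with $\Re(x)>0$. If $x\ne \frac13$, then $$\frac{\Gamma^3\left(\frac12\left(x+\frac13\right)\right)}{\Gamma^3\left(\frac12\left(x+\frac53\right)\right)}=\cfrac{2}{\left(x^2-\frac19\right)/2+\cfrac{\kappa_1}{1+\cfrac{\kappa_2}{x^2-\frac19+\cfrac{\kappa_3}{1+\cfrac{\kappa_4}{x^2-\frac19+\cdots}}}}},$$ and if $x\ne 1$, then $$\frac{\Gamma^3\left(\frac12\left(x+\frac13\right)\right)}{\Gamma^3\left(\frac12\left(x+\frac53\right)\right)}=\cfrac{2}{\left(x^2-1\right)/2+\cfrac{\nu_1}{1+\cfrac{\nu_2}{x^2-1+\cfrac{\nu_3}{1+\cfrac{\nu_4}{x^2-1+\cdots}}}}}.$$ Here, after the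 first partial denominator, the partial denominators alternate between $1$ (with numerators $\kappa_{2m-1}$, respectively $\nu_{2m-1}$) and $x^2-\frac19$, respectively $x^2-1$ (with numerators $\kappa_{2m}$, respectively $\nu_{2m}$). The equalities mean that the continued fractions converge to the left-hand side: writing $A_n/B_n$ for the approximants, with $A_n,B_n$ the canonical numerators and denominators given by the fundamental three-term recurrences, one has $B_n\neq0$ for all large $n$ and $A_n/B_n$ tends to the left-hand side as $n\to\infty$. -/

import Mathlib

open Filter Topology

noncomputable section

/-- The continued fraction
`2 / (d/2 + a₁ / (1 + a₂ / (d + a₃ / (1 + a₄ / (d + ⋯)))))`. The stream of (partial numerator,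
partial denominator) pairs starts with `(2, d/2)`, and for `n ≥ 1` its `n`-th term is `(a n, d)`
if `n` is even and `(a n, 1)` if `n` is odd. The value `a 0` is not used. -/
def alternatingContFract (d : ℂ) (a : ℕ → ℂ) : GenContFract ℂ where
  h := 0
  s := Stream'.Seq.ofStream fun n : ℕ =>
    if n = 0 then ⟨2, d / 2⟩ else if Even n then ⟨a n, d⟩ else ⟨a n, 1⟩

/-- A continued fraction converges to `τ`: its approximants `Aₙ / Bₙ` (quotients of the
canonical numerators and denominators) are eventually defined, i.e. `Bₙ ≠ 0`, and tend
to `τ`. -/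
def ContFractConvergesTo (g : GenContFract ℂ) (τ : ℂ) : Prop :=
  (∀ᶠ n in atTop, g.dens n ≠ 0) ∧ Tendsto (fun n => g.nums n / g.dens n) atTop (𝓝 τ)

end

/-! Split the approximants by parity. After division by `∏ A k`, the odd-indexed numerators and
denominators solve `A n * (V (n+1) - V n) - C n * (V n - V (n-1)) = d * V n`, and `d` times the
even-indexed ones give the companion sequence `O n = A n * (V (n+1) - V n)`. With `N = n + 1/2` the
coefficients are `(N ± α)(N ± β)(N ± γ) / N`, and `d = x² - ρ²` with `ρ = 1/2 - α - β - γ`.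
Solutions behave like `c N^(ρ+x) + c' N^(ρ-x)`. Since `Re x > 0`, the leading coefficients `cP`,
`cQ` of the numerator and denominator solutions decide convergence, and the limit is `l(x) = 2 cP /
cQ` (`QuadraticGrowth.asymptotics`, `contFractConvergesTo_of_hasSolRatio`).

The value comes from a functional equation. The operator `shiftV` carries solutions at `x` to
solutions at `x + 2`. It respects the reflection `N ↦ -N`, under which `A` and `C` change places, so
it maps even solutions to even ones and odd to odd. The numerator solution is even and the
denominator solution is odd; comparing leading coefficients expresses `l(x)` as `l(x+2)` times an
explicit rational function (`HasSolRatio.of_shift`). For large `Re d` a half-plane argument gives `l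
~ 4 / d` (`QuadraticGrowth.exists_hasSolRatio`). Iterating therefore writes `l(x)` as an infinite
product.

For `(α, β, γ) = (-1/6, 1/6, 1/6)` and `(-1/6, -1/6, -1/6)` the rational function reduces to the
same cube `((x + 5/3) / (x + 1/3))³`, so both fractions have the same Gamma quotient as value. -/

noncomputable section

/-! ### Perturbed diagonal systems with one damped component -/

/-- The pair `(a, b)` satisfies a perturbed diagonal first-order system with perturbation `ε`
in which the second component is damped by `1 - δ`. -/
def IsDampedPair (ε δ : ℕ → ℝ) (a b : ℕ → ℂ) : Prop :=
  ∀ n, ‖a (n + 1) - a n‖ ≤ ε n * (‖a n‖ + ‖b n‖) ∧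
    ‖b (n + 1)‖ ≤ (1 - δ n) * ‖b n‖ + ε n * (‖a n‖ + ‖b n‖)

namespace IsDampedPair

variable {ε δ : ℕ → ℝ} {a b : ℕ → ℂ}

theorem shift (h : IsDampedPair ε δ a b) (m : ℕ) :
    IsDampedPair (fun n => ε (n + m)) (fun n => δ (n + m)) (fun n => a (n + m))
      (fun n => b (n + m)) := by
  intro n
  have := h (n + m)
  rw [show n + m + 1 = n + 1 + m by ring] at this
  exact this

theorem norm_le (h : IsDampedPair ε δ a b) (hε : ∀ n, 0 ≤ ε n) (hs : Summable ε)
    (hδ : ∀ n, 0 ≤ δ n) (n : ℕ) :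
    ‖a n‖ + ‖b n‖ ≤ (‖a 0‖ + ‖b 0‖) * Real.exp (2 * ∑' k, ε k) := by
  have key : ‖a n‖ + ‖b n‖ ≤
      (‖a 0‖ + ‖b 0‖) * Real.exp (2 * ∑ k ∈ Finset.range n, ε k) := by
    induction n with
    | zero => simp
    | succ n ih =>
      obtain ⟨h1, h2⟩ := h n
      have h3 : ‖a (n + 1)‖ ≤ ‖a n‖ + ‖a (n + 1) - a n‖ := by
        calc ‖a (n + 1)‖ = ‖a n + (a (n + 1) - a n)‖ := by congr 1; ring
          _ ≤ _ := norm_add_le _ _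
      have h4 : ‖a (n + 1)‖ + ‖b (n + 1)‖ ≤ (2 * ε n + 1) * (‖a n‖ + ‖b n‖) := by
        nlinarith [mul_nonneg (hδ n) (norm_nonneg (b n))]
      rw [Finset.sum_range_succ, mul_add, Real.exp_add, ← mul_assoc]
      calc _ ≤ _ := h4
        _ ≤ Real.exp (2 * ε n) * (‖a n‖ + ‖b n‖) :=
          mul_le_mul_of_nonneg_right (Real.add_one_le_exp _) (by positivity)
        _ ≤ Real.exp (2 * ε n) * _ := mul_le_mul_of_nonneg_left ih (Real.exp_pos _).le
        _ = _ := by ring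
  refine key.trans ?_
  gcongr
  exact hs.sum_le_tsum _ (fun k _ => hε k)

theorem norm_sub_le (h : IsDampedPair ε δ a b) (hε : ∀ n, 0 ≤ ε n) (hs : Summable ε)
    (hδ : ∀ n, 0 ≤ δ n) (n : ℕ) :
    ‖a n - a 0‖ ≤
      (∑' k, ε k) * Real.exp (2 * ∑' k, ε k) * (‖a 0‖ + ‖b 0‖) := by
  have key : ‖a n - a 0‖ ≤ (∑ k ∈ Finset.range n, ε k) *
      ((‖a 0‖ + ‖b 0‖) * Real.exp (2 * ∑' k, ε k)) := by
    induction n with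
    | zero => simp
    | succ n ih =>
      rw [Finset.sum_range_succ, add_mul]
      calc ‖a (n + 1) - a 0‖ = ‖(a n - a 0) + (a (n + 1) - a n)‖ := by congr 1; ring
        _ ≤ _ := norm_add_le _ _
        _ ≤ _ := add_le_add ih ((h n).1.trans
          (mul_le_mul_of_nonneg_left (h.norm_le hε hs hδ n) (hε n)))
  refine key.trans ?_
  rw [mul_assoc, mul_comm (Real.exp _)]
  gcongr
  exact hs.sum_le_tsum _ (fun k _ => hε k)

theorem exists_tendsto (h : IsDampedPair ε δ a b) (hε : ∀ n, 0 ≤ ε n) (hs : Summable ε)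
    (hδ : ∀ n, 0 ≤ δ n) : ∃ c, Tendsto a atTop (𝓝 c) := by
  refine cauchySeq_tendsto_of_complete
    (cauchySeq_of_dist_le_of_summable
      (fun n => ε n * ((‖a 0‖ + ‖b 0‖) * Real.exp (2 * ∑' k, ε k))) (fun n => ?_)
      (hs.mul_right _))
  rw [dist_comm, dist_eq_norm]
  exact (h n).1.trans (mul_le_mul_of_nonneg_left (h.norm_le hε hs hδ n) (hε n))

theorem tendsto_zero (h : IsDampedPair ε δ a b) (hε : ∀ n, 0 ≤ ε n) (hs : Summable ε)
    (hδ : ∀ n, 0 ≤ δ n) (hδs : ¬ Summable δ) : Tendsto b atTop (𝓝 0) := by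
  set B := (‖a 0‖ + ‖b 0‖) * Real.exp (2 * ∑' k, ε k) with hB
  have hB0 : 0 ≤ B := by positivity
  have hstep : ∀ n, ‖b (n + 1)‖ + δ n * ‖b n‖ ≤ ‖b n‖ + ε n * B := fun n => by
    have := mul_le_mul_of_nonneg_left (h.norm_le hε hs hδ n) (hε n)
    linarith [(h n).2]
  set s : ℕ → ℝ := fun n => ∑ k ∈ Finset.range n, ε k
  -- Subtracting the accumulated perturbation makes `‖b n‖` monotone, hence convergent. A positive
  -- limit is impossible: the damping losses `δ n * ‖b n‖` are summable, which would make `δ`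
  -- summable.
  have hanti : Antitone fun n => ‖b n‖ - s n * B := by
    refine antitone_nat_of_succ_le fun n => ?_
    simp only [s, Finset.sum_range_succ, add_mul]
    linarith [hstep n, mul_nonneg (hδ n) (norm_nonneg (b n))]
  have hsle : ∀ n, s n ≤ ∑' k, ε k := fun n => hs.sum_le_tsum _ (fun k _ => hε k)
  have hbdd : BddBelow (Set.range fun n => ‖b n‖ - s n * B) := by
    refine ⟨-((∑' k, ε k) * B), ?_⟩
    rintro _ ⟨n, rfl⟩
    have := mul_le_mul_of_nonneg_right (hsle n) hB0
    have := norm_nonneg (b n)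
    show _ ≤ ‖b n‖ - s n * B
    linarith
  obtain ⟨l, hl⟩ : ∃ l, Tendsto (fun n => ‖b n‖) atTop (𝓝 l) := by
    have h1 := tendsto_atTop_ciInf hanti hbdd
    have h2 := (hs.hasSum.tendsto_sum_nat).mul_const B
    refine ⟨_, (h1.add h2).congr fun n => ?_⟩
    simp [s]
  have hl0 : 0 ≤ l := ge_of_tendsto' hl fun n => norm_nonneg _
  rcases hl0.eq_or_lt with h0 | hpos
  · rw [← h0] at hl
    exact tendsto_zero_iff_norm_tendsto_zero.2 hl
  exfalso
  have hsum : Summable fun n => δ n * ‖b n‖ := by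
    refine summable_of_sum_range_le (c := ‖b 0‖ + (∑' k, ε k) * B)
      (fun n => mul_nonneg (hδ n) (norm_nonneg _)) fun n => ?_
    have : ∑ k ∈ Finset.range n, δ k * ‖b k‖ ≤ ‖b 0‖ - ‖b n‖ + s n * B := by
      induction n with
      | zero => simp [s]
      | succ n ih =>
        simp only [s, Finset.sum_range_succ, add_mul] at ih ⊢
        linarith [hstep n]
    have h1 := mul_le_mul_of_nonneg_right (hsle n) hB0
    linarith [norm_nonneg (b n)]
  refine hδs ?_
  have hev : ∀ᶠ n in atTop, l / 2 < ‖b n‖ := hl.eventually_const_lt (by linarith)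
  obtain ⟨m, hm⟩ := eventually_atTop.1 hev
  rw [← summable_nat_add_iff m]
  refine Summable.of_nonneg_of_le (fun n => hδ _) (fun n => ?_)
    (((summable_nat_add_iff m).2 hsum).mul_left (2 / l))
  have h1 := hm (n + m) (by omega)
  have h2 := mul_le_mul_of_nonneg_left h1.le (hδ (n + m))
  rw [div_mul_eq_mul_div, le_div_iff₀ hpos]
  linarith

/-- Past a late enough index the total drift of `a`, started from `b m = 0`, is below half of `‖a
m‖`, so `a` cannot decay. One `m` serves all pairs, which allows a linear combination of solutions
to be chosen afterwards so that `b m` vanishes. -/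
theorem exists_index_not_tendsto_zero (hε : ∀ n, 0 ≤ ε n) (hs : Summable ε)
    (hδ : ∀ n, 0 ≤ δ n) : ∃ m, ∀ a b : ℕ → ℂ, IsDampedPair ε δ a b → b m = 0 → a m ≠ 0 →
      ¬ Tendsto a atTop (𝓝 0) := by
  have ht : Tendsto (fun m => (∑' k, ε (k + m)) * Real.exp (2 * ∑' k, ε (k + m))) atTop
      (𝓝 0) := by
    have h1 := tendsto_sum_nat_add ε
    have h2 := h1.mul ((Real.continuous_exp.tendsto _).comp (h1.const_mul 2))
    simpa using h2
  obtain ⟨m, hm⟩ := (ht.eventually_lt_const (show (0 : ℝ) < 1 / 2 by norm_num)).exists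
  refine ⟨m, fun a b h hb ha hlim => ?_⟩
  have h1 := fun n => (h.shift m).norm_sub_le (fun n => hε _) ((summable_nat_add_iff m).2 hs)
    (fun n => hδ _) n
  simp only [zero_add, hb, norm_zero, add_zero] at h1
  have h2 : Tendsto (fun n => ‖a (n + m) - a m‖) atTop (𝓝 ‖0 - a m‖) :=
    (((tendsto_add_atTop_iff_nat m).2 hlim).sub_const _).norm
  have h3 := le_of_tendsto' h2 h1
  rw [zero_sub, norm_neg] at h3
  have h4 : 0 < ‖a m‖ := norm_pos_iff.2 ha
  nlinarith

end IsDampedPair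

/-! ### The difference equation and the growth of its solutions -/

/-- Solutions of the first-order form of the second-order difference equation
`A n * (V (n + 1) - V n) - C n * (V n - V (n - 1)) = d * V n`, with `O n = A n * (V (n + 1) - V n)`. -/
def IsSol (A C : ℕ → ℝ) (d : ℂ) (V O : ℕ → ℂ) : Prop :=
  ∀ n, V (n + 1) = V n + O n / A n ∧ O (n + 1) = d * V (n + 1) + C (n + 1) / A n * O n

namespace IsSol

variable {A C : ℕ → ℝ} {d : ℂ} {V O V' O' : ℕ → ℂ}

theorem ext (h : IsSol A C d V O) (h' : IsSol A C d V' O') (hV : V 0 = V' 0) (hO : O 0 = O' 0)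
    (n : ℕ) : V n = V' n ∧ O n = O' n := by
  induction n with
  | zero => exact ⟨hV, hO⟩
  | succ n ih =>
    have hV1 : V (n + 1) = V' (n + 1) := by rw [(h n).1, (h' n).1, ih.1, ih.2]
    exact ⟨hV1, by rw [(h n).2, (h' n).2, hV1, ih.2]⟩

theorem combine (h : IsSol A C d V O) (h' : IsSol A C d V' O') (s t : ℂ) :
    IsSol A C d (fun n => s * V n + t * V' n) (fun n => s * O n + t * O' n) := by
  intro n
  refine ⟨?_, ?_⟩
  · simp only [(h n).1, (h' n).1]; ring
  · simp only [(h n).2, (h' n).2]; ring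

/-- Each step multiplies the Casoratian by `C (n + 1) / A n`, which is nonzero. -/
theorem casoratian_ne_zero (h : IsSol A C d V O) (h' : IsSol A C d V' O')
    (hA : ∀ n, 0 < A n) (hC : ∀ n, 0 < C n) (h0 : V 0 * O' 0 - V' 0 * O 0 ≠ 0) (n : ℕ) :
    V n * O' n - V' n * O n ≠ 0 := by
  induction n with
  | zero => exact h0
  | succ n ih =>
    have hA' : (A n : ℂ) ≠ 0 := by exact_mod_cast (hA n).ne'
    have hC' : (C (n + 1) : ℂ) ≠ 0 := by exact_mod_cast (hC (n + 1)).ne'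
    have : V (n + 1) * O' (n + 1) - V' (n + 1) * O (n + 1) =
        C (n + 1) / A n * (V n * O' n - V' n * O n) := by
      rw [(h n).2, (h' n).2, (h n).1, (h' n).1]; ring
    rw [this]
    exact mul_ne_zero (div_ne_zero hC' hA') ih

end IsSol

/-- The coefficients behave like `N ^ 2 + σ * N + O(1)` and `N ^ 2 - σ * N + O(1)`,
where `N = n + 1 / 2`. -/
structure QuadraticGrowth (A C : ℕ → ℝ) (σ : ℝ) : Prop where
  posA : ∀ n, 0 < A n
  posC : ∀ n, 0 < C n
  bound : ∃ K, ∀ n : ℕ, |A n - (((n : ℝ) + 1 / 2) ^ 2 + σ * ((n : ℝ) + 1 / 2))| ≤ K ∧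
    |C n - (((n : ℝ) + 1 / 2) ^ 2 - σ * ((n : ℝ) + 1 / 2))| ≤ K
  lower : ∃ c > 0, ∀ n : ℕ, c * ((n : ℝ) + 1 / 2) ^ 2 ≤ A n

/-- One step of the system, written for `V` and `W = O / N`, is `1 + M / N + O(1 / N ^ 2)`. -/
theorem QuadraticGrowth.step_bound {A C : ℕ → ℝ} {σ : ℝ} (hg : QuadraticGrowth A C σ) (d : ℂ) :
    ∃ K : ℝ, 0 ≤ K ∧ ∀ V O, IsSol A C d V O → ∀ n : ℕ,
      ‖V (n + 1) - V n - O n / ((n : ℂ) + 1 / 2) / ((n : ℂ) + 1 / 2)‖ ≤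
        K / ((n : ℝ) + 1 / 2) ^ 2 * (‖V n‖ + ‖O n / ((n : ℂ) + 1 / 2)‖) ∧
      ‖O (n + 1) / (((n + 1 : ℕ) : ℂ) + 1 / 2) - O n / ((n : ℂ) + 1 / 2) -
          (d * V n + (1 - 2 * σ) * (O n / ((n : ℂ) + 1 / 2))) / ((n : ℂ) + 1 / 2)‖ ≤
        K / ((n : ℝ) + 1 / 2) ^ 2 * (‖V n‖ + ‖O n / ((n : ℂ) + 1 / 2)‖) := by
  obtain ⟨K, hK⟩ := hg.bound
  obtain ⟨c, hc, hlow⟩ := hg.lower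
  have hK0 : 0 ≤ K := (abs_nonneg _).trans (hK 0).1
  set ρ := 1 - 2 * σ with hρ
  -- The summand `‖d‖` bounds the coefficient of `V n`. The numerator over `c` bounds the
  -- coefficient of `W = O n / N`, whose denominator is `A n ≥ c N²`.
  refine ⟨‖d‖ + (2 * |σ| + 2 * K + ‖d‖ + K + K + |ρ| * |σ| + |ρ| * (2 * K)) / c,
    by positivity, fun V O h n => ?_⟩
  set N : ℝ := (n : ℝ) + 1 / 2 with hN
  have hN2 : 1 / 2 ≤ N := by have := n.cast_nonneg (α := ℝ); linarith
  have hN0 : 0 < N := by linarith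
  have hNc : ((n : ℂ) + 1 / 2) = (N : ℂ) := by rw [hN]; push_cast; rfl
  have hN1c : (((n + 1 : ℕ) : ℂ) + 1 / 2) = (N : ℂ) + 1 := by rw [hN]; push_cast; ring
  have hNne : (N : ℂ) ≠ 0 := by exact_mod_cast hN0.ne'
  have hN1ne : (N : ℂ) + 1 ≠ 0 := by exact_mod_cast (by linarith : (N + 1) ≠ 0)
  have hA := hg.posA n
  have hAne : (A n : ℂ) ≠ 0 := by exact_mod_cast hA.ne'
  obtain ⟨r, hr⟩ : ∃ r, A n = N ^ 2 + σ * N + r := ⟨_, (add_sub_cancel _ _).symm⟩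
  have hrK : |r| ≤ K := by have := (hK n).1; rwa [hr, add_sub_cancel_left] at this
  obtain ⟨s, hs⟩ : ∃ s, C (n + 1) = (N + 1) ^ 2 - σ * (N + 1) + s :=
    ⟨_, (add_sub_cancel _ _).symm⟩
  have hsK : |s| ≤ K := by
    have := (hK (n + 1)).2
    rw [show ((n + 1 : ℕ) : ℝ) + 1 / 2 = N + 1 by rw [hN]; push_cast; ring, hs,
      add_sub_cancel_left] at this
    exact this
  have hrN : |r| / N ≤ 2 * K := by
    rw [div_le_iff₀ hN0]; nlinarith
  have hlow' : c * N ^ 2 ≤ A n := hlow n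
  rw [hNc, hN1c]
  set W := O n / (N : ℂ) with hW
  have hO : O n = N * W := by rw [hW]; field_simp
  have hAinv : 1 / A n ≤ 1 / c / N ^ 2 := by
    rw [div_div]; exact one_div_le_one_div_of_le (by positivity) hlow'
  constructor
  · have e : V (n + 1) - V n - W / N = ((-(σ + r / N) / A n : ℝ) : ℂ) * W := by
      rw [(h n).1, hO]
      have : (A n : ℂ) = N ^ 2 + σ * N + r := by rw [hr]; push_cast; ring
      push_cast
      field_simp
      rw [this]; ring
    rw [e, norm_mul, Complex.norm_real, Real.norm_eq_abs, abs_div, abs_neg, abs_of_pos hA]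
    have h1 : |σ + r / N| ≤ |σ| + 2 * K := by
      refine (abs_add_le _ _).trans ?_
      rw [abs_div, abs_of_pos hN0]; linarith
    have h2 : |σ + r / N| / A n ≤ (|σ| + 2 * K) / c / N ^ 2 := by
      calc _ = |σ + r / N| * (1 / A n) := by ring
        _ ≤ (|σ| + 2 * K) * (1 / c / N ^ 2) := by gcongr
        _ = _ := by ring
    have h3 : (|σ| + 2 * K) / c ≤
        ‖d‖ + (2 * |σ| + 2 * K + ‖d‖ + K + K + |ρ| * |σ| + |ρ| * (2 * K)) / c := by
      have : (|σ| + 2 * K) / c ≤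
          (2 * |σ| + 2 * K + ‖d‖ + K + K + |ρ| * |σ| + |ρ| * (2 * K)) / c := by
        refine div_le_div_of_nonneg_right ?_ hc.le
        have := abs_nonneg σ
        have : 0 ≤ |ρ| * |σ| := by positivity
        have : 0 ≤ |ρ| * (2 * K) := by positivity
        linarith [norm_nonneg d]
      linarith [norm_nonneg d]
    calc _ ≤ (|σ| + 2 * K) / c / N ^ 2 * ‖W‖ := by gcongr
      _ ≤ _ := by
        gcongr
        linarith [norm_nonneg (V n)]
  · have e : O (n + 1) / ((N : ℂ) + 1) - W - (d * V n + ρ * W) / N =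
        -(d / (N * (N + 1))) * V n +
        (N / (N + 1) * d + (((N / (N + 1) * s - r - ρ * σ - ρ * r / N : ℝ)) : ℂ)) / A n * W := by
      rw [(h n).2, (h n).1, hO]
      have : (A n : ℂ) = N ^ 2 + σ * N + r := by rw [hr]; push_cast; ring
      rw [hs]
      push_cast
      field_simp
      rw [this, hρ]; push_cast; ring
    rw [hρ] at e
    push_cast at e
    rw [e]
    push_cast [hρ]
    have hfrac : N / (N + 1) ≤ 1 := by rw [div_le_one (by linarith)]; linarith
    have hfrac0 : 0 ≤ N / (N + 1) := by positivity
    have h1 : ‖-(d / (N * (N + 1) : ℂ))‖ ≤ ‖d‖ / N ^ 2 := by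
      rw [norm_neg, norm_div, norm_mul]
      have : ‖(N : ℂ) + 1‖ = N + 1 := by
        rw [← Complex.ofReal_one, ← Complex.ofReal_add, Complex.norm_real, Real.norm_eq_abs,
          abs_of_pos (by linarith)]
      rw [this, Complex.norm_real, Real.norm_eq_abs, abs_of_pos hN0]
      gcongr
      nlinarith
    have h2 : ‖(N : ℂ) / (N + 1) * d +
        ((N : ℂ) / (N + 1) * s - r - (1 - 2 * σ) * σ - (1 - 2 * σ) * r / N)‖ ≤
        2 * |σ| + 2 * K + ‖d‖ + K + K + |ρ| * |σ| + |ρ| * (2 * K) := by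
      have e2 : (N : ℂ) / (N + 1) * d +
        ((N : ℂ) / (N + 1) * s - r - (1 - 2 * σ) * σ - (1 - 2 * σ) * r / N) =
        ((N / (N + 1) : ℝ) : ℂ) * d +
          ((N / (N + 1) * s - r - ρ * σ - ρ * (r / N) : ℝ) : ℂ) := by
        rw [hρ]; push_cast; ring
      rw [e2]
      refine (norm_add_le _ _).trans ?_
      rw [norm_mul, Complex.norm_real, Complex.norm_real, Real.norm_eq_abs, Real.norm_eq_abs,
        abs_of_nonneg hfrac0]
      have i1 : N / (N + 1) * ‖d‖ ≤ ‖d‖ := mul_le_of_le_one_left (norm_nonneg _) hfrac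
      have i2 : |N / (N + 1) * s| ≤ K := by
        rw [abs_mul, abs_of_nonneg hfrac0]
        exact (mul_le_of_le_one_left (abs_nonneg _) hfrac).trans hsK
      have i3 : |ρ * (r / N)| ≤ |ρ| * (2 * K) := by
        rw [abs_mul, abs_div, abs_of_pos hN0]; gcongr
      have i4 : |ρ * σ| = |ρ| * |σ| := abs_mul _ _
      have i5 := abs_sub (N / (N + 1) * s - r - ρ * σ) (ρ * (r / N))
      have i6 := abs_sub (N / (N + 1) * s - r) (ρ * σ)
      have i7 := abs_sub (N / (N + 1) * s) r
      have := abs_nonneg σ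
      linarith
    refine (norm_add_le _ _).trans ?_
    rw [norm_mul, norm_mul, norm_div, Complex.norm_real (A n), Real.norm_eq_abs, abs_of_pos hA]
    set B := 2 * |σ| + 2 * K + ‖d‖ + K + K + |ρ| * |σ| + |ρ| * (2 * K) with hB
    have hB0 : 0 ≤ B := by positivity
    have h3 : ‖(N : ℂ) / (N + 1) * d +
        ((N : ℂ) / (N + 1) * s - r - (1 - 2 * σ) * σ - (1 - 2 * σ) * r / N)‖ / A n ≤
        B / c / N ^ 2 := by
      calc _ = ‖(N : ℂ) / (N + 1) * d +
        ((N : ℂ) / (N + 1) * s - r - (1 - 2 * σ) * σ - (1 - 2 * σ) * r / N)‖ * (1 / A n) := by ring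
        _ ≤ B * (1 / c / N ^ 2) := by gcongr
        _ = _ := by ring
    calc _ ≤ ‖d‖ / N ^ 2 * ‖V n‖ + B / c / N ^ 2 * ‖W‖ := by gcongr
      _ ≤ (‖d‖ / N ^ 2 + B / c / N ^ 2) * (‖V n‖ + ‖W‖) := by
        have : 0 ≤ ‖d‖ / N ^ 2 * ‖W‖ := by positivity
        have : 0 ≤ B / c / N ^ 2 * ‖V n‖ := by positivity
        linarith
      _ = _ := by ring

theorem not_summable_one_div_nat_add_half : ¬ Summable fun n : ℕ => 1 / ((n : ℝ) + 1 / 2) := by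
  intro h
  refine (summable_nat_add_iff 1).not.2 Real.not_summable_one_div_natCast
    (Summable.of_nonneg_of_le (fun n => by positivity) (fun n => ?_) h)
  push_cast
  exact one_div_le_one_div_of_le (by positivity) (by linarith)

theorem summable_div_nat_add_half_sq (K : ℝ) :
    Summable fun n : ℕ => K / ((n : ℝ) + 1 / 2) ^ 2 := by
  have h : Summable fun n : ℕ => 4 * |K| * (1 / ((n + 1 : ℕ) : ℝ) ^ 2) :=
    ((summable_nat_add_iff 1).2 (Real.summable_one_div_nat_pow.2 one_lt_two)).mul_left _
  refine Summable.of_norm_bounded h fun n => ?_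
  rw [norm_div, Real.norm_eq_abs, Real.norm_eq_abs, abs_of_pos (by positivity : (0:ℝ) <
    ((n : ℝ) + 1 / 2) ^ 2), mul_one_div, div_le_div_iff₀ (by positivity) (by positivity)]
  push_cast
  have := abs_nonneg K
  have hn := n.cast_nonneg (α := ℝ)
  nlinarith [mul_nonneg this hn, mul_nonneg (mul_nonneg this hn) hn]

/-- The quotient of the two growth factors `1 + (ρ ± x) / N`. -/
theorem exists_norm_div_le {x : ℂ} (hx : 0 < x.re) {ρ : ℝ} (hρ : 0 < ρ) :
    ∃ k > 0, ∀ n : ℕ, ‖((n : ℂ) + 1 / 2 + (ρ - x)) / ((n : ℂ) + 1 / 2 + (ρ + x))‖ ≤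
      1 - k * (1 / ((n : ℝ) + 1 / 2)) := by
  set k : ℝ := min (1 / 4) (x.re / (4 * (1 + 2 * ρ + 2 * ‖x‖) ^ 2)) with hk
  have hk0 : 0 < k := by rw [hk]; positivity
  refine ⟨k, hk0, fun n => ?_⟩
  set N : ℝ := (n : ℝ) + 1 / 2 with hN
  have hN2 : 1 / 2 ≤ N := by have := n.cast_nonneg (α := ℝ); linarith
  have hNc : ((n : ℂ) + 1 / 2) = (N : ℂ) := by rw [hN]; push_cast; rfl
  rw [hNc]
  set z : ℂ := N + (ρ + x)
  set w : ℂ := N + (ρ - x)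
  have hz : ‖z‖ ^ 2 = (N + ρ + x.re) ^ 2 + x.im ^ 2 := by
    rw [Complex.sq_norm, Complex.normSq_apply]; simp [z]; ring
  have hw : ‖w‖ ^ 2 = (N + ρ - x.re) ^ 2 + x.im ^ 2 := by
    rw [Complex.sq_norm, Complex.normSq_apply]; simp [w]; ring
  have hzpos : 0 < ‖z‖ := by
    have : 0 < ‖z‖ ^ 2 := by rw [hz]; positivity
    exact (norm_nonneg z).lt_of_ne fun h0 => by simp [← h0] at this
  have hzle : ‖z‖ ≤ (1 + 2 * ρ + 2 * ‖x‖) * N := by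
    have : ‖z‖ ≤ N + (ρ + ‖x‖) := by
      refine (norm_add_le _ _).trans (add_le_add ?_ ((norm_add_le _ _).trans ?_))
      · simp [abs_of_pos (by linarith : 0 < N)]
      · simp [abs_of_pos hρ]
    nlinarith [norm_nonneg x]
  have hk1 : k * (1 / N) ≤ 1 / 2 := by
    rw [mul_one_div, div_le_iff₀ (by linarith)]
    have : k ≤ 1 / 4 := min_le_left _ _
    linarith
  have hk2 : k * (4 * (1 + 2 * ρ + 2 * ‖x‖) ^ 2) ≤ x.re := by
    have : k ≤ x.re / (4 * (1 + 2 * ρ + 2 * ‖x‖) ^ 2) := min_le_right _ _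
    rwa [le_div_iff₀ (by positivity)] at this
  rw [norm_div]
  refine (sq_le_sq₀ (by positivity) (by linarith)).1 ?_
  rw [div_pow, div_le_iff₀ (by positivity)]
  have h1 : ‖w‖ ^ 2 = ‖z‖ ^ 2 - 4 * (N + ρ) * x.re := by rw [hw, hz]; ring
  have h2 : ‖z‖ ^ 2 ≤ (1 + 2 * ρ + 2 * ‖x‖) ^ 2 * N ^ 2 := by
    rw [← mul_pow]; gcongr
  have h3 : 2 * (k * (1 / N)) * ‖z‖ ^ 2 ≤ 4 * (N + ρ) * x.re := by
    calc 2 * (k * (1 / N)) * ‖z‖ ^ 2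
        ≤ 2 * (k * (1 / N)) * ((1 + 2 * ρ + 2 * ‖x‖) ^ 2 * N ^ 2) := by
          gcongr
      _ = 2 * N * (k * (1 + 2 * ρ + 2 * ‖x‖) ^ 2) := by
          have : N ≠ 0 := by linarith
          field_simp
      _ ≤ 4 * (N + ρ) * x.re := by nlinarith
  nlinarith [mul_nonneg (sq_nonneg (k * (1 / N))) (sq_nonneg ‖z‖)]

/-- The leading growth `N ^ (ρ + x)` of the solutions, as a product. -/
def growthFactor (μ : ℂ) (n : ℕ) : ℂ := ∏ k ∈ Finset.range n, (1 + μ / ((k : ℂ) + 1 / 2))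

theorem one_le_norm_one_add_div {μ : ℂ} (hμ : 0 < μ.re) (k : ℕ) :
    1 ≤ ‖1 + μ / ((k : ℂ) + 1 / 2)‖ := by
  have hNc : ((k : ℂ) + 1 / 2) = (((k : ℝ) + 1 / 2 : ℝ) : ℂ) := by push_cast; rfl
  refine le_trans ?_ (Complex.re_le_norm _)
  rw [hNc, Complex.add_re, Complex.div_ofReal_re, Complex.one_re]
  have : 0 ≤ μ.re / ((k : ℝ) + 1 / 2) := by positivity
  linarith

theorem growthFactor_ne_zero {μ : ℂ} (hμ : 0 < μ.re) (n : ℕ) : growthFactor μ n ≠ 0 :=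
  Finset.prod_ne_zero_iff.2 fun k _ => norm_pos_iff.1
    (one_pos.trans_le (one_le_norm_one_add_div hμ k))

/-- Every solution grows like a multiple of `growthFactor (ρ + x)`, and two linearly independent
solutions are not both of smaller order. -/
theorem QuadraticGrowth.asymptotics {A C : ℕ → ℝ} {σ ρ : ℝ} (hg : QuadraticGrowth A C σ)
    (hσ : ρ = 1 / 2 - σ) (hρ : 0 < ρ) {x : ℂ} (hx : 0 < x.re) :
    (∀ V O, IsSol A C (x ^ 2 - ρ ^ 2) V O → ∃ c,
      Tendsto (fun n => V n / growthFactor (ρ + x) n) atTop (𝓝 c) ∧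
      Tendsto (fun n : ℕ => O n / ((n : ℂ) + 1 / 2) / growthFactor (ρ + x) n) atTop
        (𝓝 ((ρ + x) * c))) ∧
    ∀ V O V' O', IsSol A C (x ^ 2 - ρ ^ 2) V O → IsSol A C (x ^ 2 - ρ ^ 2) V' O' →
      V 0 * O' 0 - V' 0 * O 0 ≠ 0 →
      Tendsto (fun n => V n / growthFactor (ρ + x) n) atTop (𝓝 0) →
      ¬ Tendsto (fun n => V' n / growthFactor (ρ + x) n) atTop (𝓝 0) := by
  obtain ⟨K, hK0, hK⟩ := hg.step_bound (x ^ 2 - (ρ : ℂ) ^ 2)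
  obtain ⟨k, hk0, hk⟩ := exists_norm_div_le hx hρ
  have hx0 : x ≠ 0 := fun h => by simp [h] at hx
  set p := growthFactor (ρ + x) with hp
  have hre : 0 < ((ρ : ℂ) + x).re := by simp; linarith
  have hp0 : ∀ n, p n ≠ 0 := growthFactor_ne_zero hre
  have hps : ∀ n, p (n + 1) = p n * (1 + (ρ + x) / ((n : ℂ) + 1 / 2)) :=
    fun n => Finset.prod_range_succ _ _
  have hpn : ∀ n, ‖p n‖ ≤ ‖p (n + 1)‖ := fun n => by
    rw [hps, norm_mul]
    exact le_mul_of_one_le_right (norm_nonneg _) (one_le_norm_one_add_div hre n)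
  set Mx : ℝ := 1 + ‖ρ - x‖ + ‖ρ + x‖ with hMx
  have hx2 : 0 < ‖2 * x‖ := norm_pos_iff.2 (by simpa using hx0)
  -- One factor `Mx` bounds the combination of the two step errors; `2 * Mx / ‖2 * x‖` is the cost
  -- of recovering `V` and `W` from `a` and `b`.
  set ε : ℕ → ℝ := fun n => (K * Mx * (2 * Mx) / ‖2 * x‖) / ((n : ℝ) + 1 / 2) ^ 2 with hε
  set δ : ℕ → ℝ := fun n => k * (1 / ((n : ℝ) + 1 / 2)) with hδ
  have hε0 : ∀ n, 0 ≤ ε n := fun n => by positivity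
  have hδ0 : ∀ n, 0 ≤ δ n := fun n => by positivity
  have hεs : Summable ε := summable_div_nat_add_half_sq _
  have hδs : ¬ Summable δ := fun h => not_summable_one_div_nat_add_half
    ((summable_mul_left_iff hk0.ne').1 h)
  -- The leading step matrix on `(V, W)` has rows `(0, 1)` and `(d, 2ρ)`, with eigenvalues `ρ ± x`.
  -- Its left eigenvectors give `a` (growth `ρ + x`) and `b` (growth `ρ - x`); division by `p` makes
  -- `a` nearly constant and `b` damped.
  let a : (ℕ → ℂ) → (ℕ → ℂ) → ℕ → ℂ := fun V O n =>
    (O n / ((n : ℂ) + 1 / 2) - (ρ - x) * V n) / p n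
  let b : (ℕ → ℂ) → (ℕ → ℂ) → ℕ → ℂ := fun V O n =>
    (O n / ((n : ℂ) + 1 / 2) - (ρ + x) * V n) / p n
  have hNne : ∀ n : ℕ, ((n : ℂ) + 1 / 2) ≠ 0 := fun n => by
    have : ((n : ℂ) + 1 / 2) = (((n : ℝ) + 1 / 2 : ℝ) : ℂ) := by push_cast; rfl
    rw [this]; exact_mod_cast (by positivity : ((n : ℝ) + 1 / 2) ≠ 0)
  have hVab : ∀ V O n, V n / p n = (a V O n - b V O n) / (2 * x) := fun V O n => by
    simp only [a, b]; field_simp [hp0 n]; ring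
  have hWab : ∀ V O, ∀ n : ℕ, O n / ((n : ℂ) + 1 / 2) / p n =
      ((ρ + x) * a V O n - (ρ - x) * b V O n) / (2 * x) := fun V O n => by
    simp only [a, b]
    generalize O n / ((n : ℂ) + 1 / 2) = W
    field_simp [hp0 n]; ring
  have hpair : ∀ V O, IsSol A C (x ^ 2 - ρ ^ 2) V O → IsDampedPair ε δ (a V O) (b V O) := by
    intro V O h n
    obtain ⟨h1, h2⟩ := hK V O h n
    set N : ℂ := (n : ℂ) + 1 / 2 with hN
    set W := O n / N with hW
    set W1 := O (n + 1) / (((n + 1 : ℕ) : ℂ) + 1 / 2) with hW1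
    set g1 := V (n + 1) - V n - W / N with hg1
    set g2 := W1 - W - ((x ^ 2 - ρ ^ 2) * V n + (1 - 2 * σ) * W) / N with hg2
    have hN0 : N ≠ 0 := hNne n
    have hσ' : (1 - 2 * (σ : ℂ)) = 2 * ρ := by rw [hσ]; push_cast; ring
    have hpne : 1 + (ρ + x) / N ≠ 0 := by
      have := hp0 (n + 1); rw [hps] at this; exact right_ne_zero_of_mul this
    have hN1 : N + (ρ + x) ≠ 0 := by
      intro h0; apply hpne; field_simp; rw [h0, mul_zero]
    set S : ℝ := K / ((n : ℝ) + 1 / 2) ^ 2 * (‖V n‖ + ‖W‖) with hS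
    have hS0 : 0 ≤ S := by positivity
    have hSp : S / ‖p (n + 1)‖ * Mx ≤ ε n * (‖a V O n‖ + ‖b V O n‖) := by
      have hVn : ‖V n‖ / ‖p n‖ ≤ Mx * (‖a V O n‖ + ‖b V O n‖) / ‖2 * x‖ := by
        rw [← norm_div, hVab V O n, norm_div]
        gcongr
        refine (norm_sub_le _ _).trans ?_
        have : 1 ≤ Mx := by rw [hMx]; linarith [norm_nonneg ((ρ : ℂ) - x), norm_nonneg ((ρ : ℂ) + x)]
        exact le_mul_of_one_le_left (by positivity) this
      have hWn : ‖W‖ / ‖p n‖ ≤ Mx * (‖a V O n‖ + ‖b V O n‖) / ‖2 * x‖ := by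
        rw [← norm_div, hWab V O n, norm_div]
        gcongr
        refine (norm_sub_le _ _).trans ?_
        rw [norm_mul, norm_mul, mul_add]
        gcongr <;> rw [hMx] <;> linarith [norm_nonneg ((ρ : ℂ) - x), norm_nonneg ((ρ : ℂ) + x)]
      have hpnpos : 0 < ‖p n‖ := norm_pos_iff.2 (hp0 n)
      calc S / ‖p (n + 1)‖ * Mx ≤ S / ‖p n‖ * Mx := by
            gcongr
            exact hpn n
        _ = K / ((n : ℝ) + 1 / 2) ^ 2 * (‖V n‖ / ‖p n‖ + ‖W‖ / ‖p n‖) * Mx := by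
            rw [hS]; ring
        _ ≤ K / ((n : ℝ) + 1 / 2) ^ 2 * (Mx * (‖a V O n‖ + ‖b V O n‖) / ‖2 * x‖ +
            Mx * (‖a V O n‖ + ‖b V O n‖) / ‖2 * x‖) * Mx := by gcongr
        _ = ε n * (‖a V O n‖ + ‖b V O n‖) := by simp only [hε]; ring
    have hcomb : ∀ μ : ℂ, ‖μ‖ ≤ ‖ρ - x‖ + ‖ρ + x‖ → ‖(g2 - μ * g1) / p (n + 1)‖ ≤
        ε n * (‖a V O n‖ + ‖b V O n‖) := by
      intro μ hμ
      refine le_trans ?_ hSp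
      rw [norm_div, div_mul_eq_mul_div]
      gcongr
      refine (norm_sub_le _ _).trans ?_
      rw [norm_mul]
      calc _ ≤ S + (‖ρ - x‖ + ‖ρ + x‖) * S := by gcongr
        _ = S * Mx := by rw [hMx]; ring
    have hpeq : p (n + 1) = p n * (N + (ρ + x)) / N := by
      rw [hps, ← hN]; field_simp
    have ha : a V O (n + 1) - a V O n = (g2 - (ρ - x) * g1) / p (n + 1) := by
      simp only [a]
      rw [← hW1, ← hW, hg1, hg2, hσ', hpeq]
      field_simp [hp0 n]
      ring
    have hb : b V O (n + 1) = (N + (ρ - x)) / (N + (ρ + x)) * b V O n +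
        (g2 - (ρ + x) * g1) / p (n + 1) := by
      simp only [b]
      rw [← hW1, ← hW, hg1, hg2, hσ', hpeq]
      field_simp [hp0 n]
      ring
    refine ⟨?_, ?_⟩
    · rw [ha]
      exact hcomb _ (by linarith [norm_nonneg ((ρ : ℂ) + x)])
    · rw [hb]
      refine (norm_add_le _ _).trans (add_le_add ?_
        (hcomb _ (by linarith [norm_nonneg ((ρ : ℂ) - x)])))
      rw [norm_mul]
      exact mul_le_mul_of_nonneg_right (hk n) (norm_nonneg _)
  refine ⟨fun V O h => ?_, fun V O V' O' h h' h0 hV hV' => ?_⟩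
  · obtain ⟨c, hc⟩ := (hpair V O h).exists_tendsto hε0 hεs hδ0
    have hb := (hpair V O h).tendsto_zero hε0 hεs hδ0 hδs
    refine ⟨c / (2 * x), ?_, ?_⟩
    · simp only [hVab V O]
      simpa using (hc.sub hb).div_const (2 * x)
    · simp only [hWab V O]
      have := ((hc.const_mul (ρ + x)).sub (hb.const_mul (ρ - x))).div_const (2 * x)
      rw [mul_zero, sub_zero, mul_div_assoc] at this
      exact this
  · obtain ⟨m, hm⟩ := IsDampedPair.exists_index_not_tendsto_zero hε0 hεs hδ0
    -- This combination has `b m = 0`, while its `a m` is a nonzero multiple of the Casoratian. If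
    -- both solutions were of smaller order, its `a` would tend to zero.
    have hsol := h.combine h' (b V' O' m) (-b V O m)
    have hlin : ∀ n, (b V' O' m * V n + -b V O m * V' n) / p n =
        b V' O' m * (V n / p n) + -b V O m * (V' n / p n) := fun n => by ring
    refine hm _ _ (hpair _ _ hsol) ?_ ?_ ?_
    · simp only [b]; ring
    · have hcas := h.casoratian_ne_zero h' hg.posA hg.posC h0 m
      have e : a (fun n => b V' O' m * V n + -b V O m * V' n)
          (fun n => b V' O' m * O n + -b V O m * O' n) m =
          (V m * O' m - V' m * O m) * (2 * x) / ((m : ℂ) + 1 / 2) / p m ^ 2 := by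
        have := hNne m
        simp only [a, b]
        generalize (m : ℂ) + 1 / 2 = N at *
        field_simp [hp0 m]
        ring
      rw [e]
      have := hNne m
      have := hp0 m
      simp only [ne_eq, mul_eq_zero, div_eq_zero_iff, not_or]
      simp_all
    · have hz : Tendsto (fun n => (b V' O' m * V n + -b V O m * V' n) / p n) atTop (𝓝 0) := by
        simp only [hlin]
        simpa using (hV.const_mul (b V' O' m)).add (hV'.const_mul (-b V O m))
      have hb := (hpair _ _ hsol).tendsto_zero hε0 hεs hδ0 hδs
      have := (hz.const_mul (2 * x)).add hb
      rw [mul_zero, add_zero] at this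
      refine this.congr fun n => ?_
      rw [hVab (fun n => b V' O' m * V n + -b V O m * V' n)
        (fun n => b V' O' m * O n + -b V O m * O' n) n]
      field_simp
      ring

/-! ### The concrete coefficients -/

/-- `(N + α) (N + β) (N + γ) / N` with `N = n + 1 / 2`. -/
def upCoeff (α β γ : ℝ) (n : ℕ) : ℝ :=
  ((n : ℝ) + 1 / 2 + α) * ((n : ℝ) + 1 / 2 + β) * ((n : ℝ) + 1 / 2 + γ) / ((n : ℝ) + 1 / 2)

/-- `(N - α) (N - β) (N - γ) / N` with `N = n + 1 / 2`. -/
def downCoeff (α β γ : ℝ) (n : ℕ) : ℝ := upCoeff (-α) (-β) (-γ) n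

theorem upCoeff_pos {α β γ : ℝ} (hα : |α| < 1 / 2) (hβ : |β| < 1 / 2) (hγ : |γ| < 1 / 2) (n : ℕ) :
    0 < upCoeff α β γ n := by
  have hn := n.cast_nonneg (α := ℝ)
  rw [abs_lt] at hα hβ hγ
  have h1 : 0 < (n : ℝ) + 1 / 2 + α := by linarith
  have h2 : 0 < (n : ℝ) + 1 / 2 + β := by linarith
  have h3 : 0 < (n : ℝ) + 1 / 2 + γ := by linarith
  unfold upCoeff
  positivity

theorem downCoeff_pos {α β γ : ℝ} (hα : |α| < 1 / 2) (hβ : |β| < 1 / 2) (hγ : |γ| < 1 / 2)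
    (n : ℕ) : 0 < downCoeff α β γ n :=
  upCoeff_pos (by rwa [abs_neg]) (by rwa [abs_neg]) (by rwa [abs_neg]) n

theorem exists_abs_upCoeff_sub_le (α β γ : ℝ) : ∃ K, ∀ n : ℕ,
    |upCoeff α β γ n - (((n : ℝ) + 1 / 2) ^ 2 + (α + β + γ) * ((n : ℝ) + 1 / 2))| ≤ K := by
  refine ⟨|α * β + α * γ + β * γ| + 2 * |α * β * γ|, fun n => ?_⟩
  have hn := n.cast_nonneg (α := ℝ)
  have hN : (0 : ℝ) < (n : ℝ) + 1 / 2 := by linarith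
  unfold upCoeff
  set N := (n : ℝ) + 1 / 2
  have e : (N + α) * (N + β) * (N + γ) / N - (N ^ 2 + (α + β + γ) * N) =
      (α * β + α * γ + β * γ) + α * β * γ / N := by field_simp; ring
  rw [e]
  refine (abs_add_le _ _).trans (add_le_add le_rfl ?_)
  rw [abs_div, abs_of_pos hN, div_le_iff₀ hN]
  have : 1 / 2 ≤ N := by simp only [N]; linarith
  nlinarith [abs_nonneg (α * β * γ)]

theorem exists_mul_le_upCoeff {α β γ : ℝ} (hα : |α| < 1 / 2) (hβ : |β| < 1 / 2)
    (hγ : |γ| < 1 / 2) : ∃ c > 0, ∀ n : ℕ, c * ((n : ℝ) + 1 / 2) ^ 2 ≤ upCoeff α β γ n := by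
  refine ⟨(1 - 2 * |α|) * (1 - 2 * |β|) * (1 - 2 * |γ|), ?_, fun n => ?_⟩
  · have h1 : 0 < 1 - 2 * |α| := by linarith
    have h2 : 0 < 1 - 2 * |β| := by linarith
    have h3 : 0 < 1 - 2 * |γ| := by linarith
    positivity
  have hn := n.cast_nonneg (α := ℝ)
  have hN : (0 : ℝ) < (n : ℝ) + 1 / 2 := by linarith
  -- Uses `N ≥ 1/2`, so that `|τ| ≤ 2 |τ| N`.
  have key : ∀ τ : ℝ, |τ| < 1 / 2 → (1 - 2 * |τ|) * ((n : ℝ) + 1 / 2) ≤ (n : ℝ) + 1 / 2 + τ := by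
    intro τ hτ
    have h1 := neg_abs_le τ
    have h2 := abs_nonneg τ
    nlinarith
  unfold upCoeff
  rw [le_div_iff₀ hN]
  have a1 := key α hα
  have a2 := key β hβ
  have a3 := key γ hγ
  set N := (n : ℝ) + 1 / 2
  have p1 : 0 ≤ (1 - 2 * |α|) * N := mul_nonneg (by linarith) hN.le
  have p2 : 0 ≤ (1 - 2 * |β|) * N := mul_nonneg (by linarith) hN.le
  have p3 : 0 ≤ (1 - 2 * |γ|) * N := mul_nonneg (by linarith) hN.le
  calc _ = (1 - 2 * |α|) * N * ((1 - 2 * |β|) * N) * ((1 - 2 * |γ|) * N) := by ring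
    _ ≤ (N + α) * (N + β) * (N + γ) := by
      apply mul_le_mul (mul_le_mul a1 a2 p2 (p1.trans a1)) a3 p3
      exact mul_nonneg (p1.trans a1) (p2.trans a2)

theorem quadraticGrowth {α β γ : ℝ} (hα : |α| < 1 / 2) (hβ : |β| < 1 / 2) (hγ : |γ| < 1 / 2) :
    QuadraticGrowth (upCoeff α β γ) (downCoeff α β γ) (α + β + γ) where
  posA := upCoeff_pos hα hβ hγ
  posC := downCoeff_pos hα hβ hγ
  bound := by
    obtain ⟨K, hK⟩ := exists_abs_upCoeff_sub_le α β γ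
    obtain ⟨K', hK'⟩ := exists_abs_upCoeff_sub_le (-α) (-β) (-γ)
    refine ⟨max K K', fun n => ⟨(hK n).trans (le_max_left _ _), ?_⟩⟩
    have e : -α + -β + -γ = -(α + β + γ) := by ring
    have h := (hK' n).trans (le_max_right K K')
    rwa [e, neg_mul, ← sub_eq_add_neg] at h
  lower := exists_mul_le_upCoeff hα hβ hγ

/-! ### The operator shifting `x` to `x + 2` -/

/-- The coefficient of `V` in the shift operator. -/
def shiftCoeff (α β γ x N : ℂ) : ℂ :=
  (x - (1 / 2 - α - β - γ)) * (2 * (x + 1) * (N ^ 2 - 1 / 4) +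
    (x + 3 / 2 + α - β - γ) * (x + 3 / 2 - α + β - γ) * (x + 3 / 2 - α - β + γ) / 4 -
    (x + 1) * (x + (1 / 2 - α - β - γ)) / 2)

/-- Here `q` and `r` are the backward and forward differences of `V` at `M`, and the `T`s are the
images at `M - 1`, `M`, `M + 1`. `T₀` is written through the polynomial `M A(M)` at `M - 1`, so it
still makes sense for `M = 1/2`, where the sequence has no earlier term. -/
theorem shift_identity (α β γ x M V q r : ℂ) {d d' T₀ T₁ T₂ : ℂ}
    (hd : d = x ^ 2 - (1 / 2 - α - β - γ) ^ 2) (hd' : d' = (x + 2) ^ 2 - (1 / 2 - α - β - γ) ^ 2)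
    (h : (M + α) * (M + β) * (M + γ) * r = M * d * V + (M - α) * (M - β) * (M - γ) * q)
    (h₀ : T₀ = (shiftCoeff α β γ x (M - 1) - (x + 1) * (M - 1) * d) * (V - q) +
      2 * (x + 1) * ((M - 1 + α) * (M - 1 + β) * (M - 1 + γ)) * q)
    (h₁ : T₁ = (shiftCoeff α β γ x M - (x + 1) * M * d) * V +
      2 * (x + 1) * (M * d * V + (M - α) * (M - β) * (M - γ) * q))
    (h₂ : T₂ = (shiftCoeff α β γ x (M + 1) - (x + 1) * (M + 1) * d) * (V + r) +
      2 * (x + 1) * ((M + 1) * d * (V + r) + (M + 1 - α) * (M + 1 - β) * (M + 1 - γ) * r)) :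
    (M + α) * (M + β) * (M + γ) * (T₂ - T₁) =
      M * d' * T₁ + (M - α) * (M - β) * (M - γ) * (T₁ - T₀) := by
  subst hd; rw [h₀, h₁, h₂, hd']; unfold shiftCoeff
  -- The multiplier is the coefficient of `r` in `T₂`; eliminating `r` leaves a polynomial identity
  -- in `V` and `q`.
  linear_combination ((x - (1 / 2 - α - β - γ)) * (2 * (x + 1) * ((M + 1) ^ 2 - 1 / 4) +
    (x + 3 / 2 + α - β - γ) * (x + 3 / 2 - α + β - γ) * (x + 3 / 2 - α - β + γ) / 4 -
    (x + 1) * (x + (1 / 2 - α - β - γ)) / 2) +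
    (x + 1) * (M + 1) * (x ^ 2 - (1 / 2 - α - β - γ) ^ 2) +
    2 * (x + 1) * ((M + 1 - α) * (M + 1 - β) * (M + 1 - γ))) * h

/-- The operator taking solutions at `x` to solutions at `x + 2`. -/
def shiftV (α β γ : ℝ) (x d : ℂ) (V O : ℕ → ℂ) (n : ℕ) : ℂ :=
  (shiftCoeff α β γ x ((n : ℂ) + 1 / 2) - (x + 1) * ((n : ℂ) + 1 / 2) * d) * V n +
    2 * (x + 1) * ((n : ℂ) + 1 / 2) * O n

/-- The second component of `shiftV`. -/
def shiftO (α β γ : ℝ) (x d : ℂ) (V O : ℕ → ℂ) (n : ℕ) : ℂ :=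
  upCoeff α β γ n * (shiftV α β γ x d V O (n + 1) - shiftV α β γ x d V O n)

theorem natCast_add_half_ne_zero (n : ℕ) : (n : ℂ) + 1 / 2 ≠ 0 := by
  have : ((n : ℂ) + 1 / 2) = (((n : ℝ) + 1 / 2 : ℝ) : ℂ) := by push_cast; rfl
  rw [this]
  exact_mod_cast (by positivity : ((n : ℝ) + 1 / 2) ≠ 0)

theorem mul_upCoeff (α β γ : ℝ) (n : ℕ) : ((n : ℂ) + 1 / 2) * upCoeff α β γ n =
    ((n : ℂ) + 1 / 2 + α) * ((n : ℂ) + 1 / 2 + β) * ((n : ℂ) + 1 / 2 + γ) := by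
  have := natCast_add_half_ne_zero n
  unfold upCoeff
  push_cast
  rw [mul_div_cancel₀ _ this]

theorem mul_downCoeff (α β γ : ℝ) (n : ℕ) : ((n : ℂ) + 1 / 2) * downCoeff α β γ n =
    ((n : ℂ) + 1 / 2 - α) * ((n : ℂ) + 1 / 2 - β) * ((n : ℂ) + 1 / 2 - γ) := by
  rw [downCoeff, mul_upCoeff]
  push_cast
  ring

section Shift

variable {α β γ : ℝ} {x d d' : ℂ} {V O : ℕ → ℂ}

/-- The image of a solution under `shiftV` satisfies the second-order equation at index `n`;
`q` is the backward difference of `V` at `n`. -/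
theorem shiftV_second_order (hA : ∀ n, upCoeff α β γ n ≠ 0)
    (hd : d = x ^ 2 - (1 / 2 - α - β - γ) ^ 2) (hd' : d' = (x + 2) ^ 2 - (1 / 2 - α - β - γ) ^ 2)
    (h : IsSol (upCoeff α β γ) (downCoeff α β γ) d V O) (n : ℕ) (q T₀ : ℂ)
    (hq : O n = d * V n + downCoeff α β γ n * q)
    (h₀ : T₀ = (shiftCoeff α β γ x ((n : ℂ) + 1 / 2 - 1) - (x + 1) * ((n : ℂ) + 1 / 2 - 1) * d) *
        (V n - q) +
      2 * (x + 1) * (((n : ℂ) + 1 / 2 - 1 + α) * ((n : ℂ) + 1 / 2 - 1 + β) *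
        ((n : ℂ) + 1 / 2 - 1 + γ)) * q) :
    shiftO α β γ x d V O n = d' * shiftV α β γ x d V O n +
      downCoeff α β γ n * (shiftV α β γ x d V O n - T₀) := by
  have hM := natCast_add_half_ne_zero n
  have hAn : (upCoeff α β γ n : ℂ) ≠ 0 := by exact_mod_cast hA n
  have hAn1 : (upCoeff α β γ (n + 1) : ℂ) ≠ 0 := by exact_mod_cast hA (n + 1)
  have e1 := mul_upCoeff α β γ n
  have e2 := mul_downCoeff α β γ n
  have e3 := mul_downCoeff α β γ (n + 1)
  have hc : ((n + 1 : ℕ) : ℂ) + 1 / 2 = (n : ℂ) + 1 / 2 + 1 := by push_cast; ring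
  have hT₂ := shiftV.eq_1 α β γ x d V O (n + 1)
  rw [hc] at e3 hT₂
  rw [(h n).1, show O (n + 1) = d * (V n + O n / upCoeff α β γ n) +
    downCoeff α β γ (n + 1) * (O n / upCoeff α β γ n) by rw [(h n).2, (h n).1]; ring] at hT₂
  rw [shiftO]
  set M := (n : ℂ) + 1 / 2
  have hr : upCoeff α β γ n * (O n / upCoeff α β γ n) = O n := mul_div_cancel₀ _ hAn
  set r := O n / (upCoeff α β γ n : ℂ)
  have key := shift_identity α β γ x M (V n) q r (T₁ := shiftV α β γ x d V O n)
    (T₂ := shiftV α β γ x d V O (n + 1)) hd hd'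
    (by rw [← e1, ← e2]; linear_combination M * hr + M * hq) h₀
    (by rw [← e2, shiftV, hq]; ring)
    (by rw [← e3, hT₂]; ring)
  rw [← e1, ← e2] at key
  refine mul_left_cancel₀ hM ?_
  linear_combination key

theorem shift_isSol (hA : ∀ n, upCoeff α β γ n ≠ 0)
    (hd : d = x ^ 2 - (1 / 2 - α - β - γ) ^ 2) (hd' : d' = (x + 2) ^ 2 - (1 / 2 - α - β - γ) ^ 2)
    (h : IsSol (upCoeff α β γ) (downCoeff α β γ) d V O) :
    IsSol (upCoeff α β γ) (downCoeff α β γ) d' (shiftV α β γ x d V O) (shiftO α β γ x d V O) := by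
  intro n
  have hAn : (upCoeff α β γ n : ℂ) ≠ 0 := by exact_mod_cast hA n
  refine ⟨?_, ?_⟩
  · rw [shiftO, mul_div_cancel_left₀ _ hAn]; ring
  -- At index `n + 1` the predecessor is genuine, with backward difference `O n / A n`.
  · rw [shiftV_second_order hA hd hd' h (n + 1) (O n / upCoeff α β γ n) (shiftV α β γ x d V O n)
      (by rw [(h n).2]; ring) ?_, shiftO]
    · field_simp
    · have e := mul_upCoeff α β γ n
      have hc : ((n + 1 : ℕ) : ℂ) + 1 / 2 - 1 = (n : ℂ) + 1 / 2 := by push_cast; ring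
      rw [hc, ← e, (h n).1, shiftV]
      field_simp
      ring

/-- The even solution is mapped to a multiple of the even solution. -/
theorem shift_even (hA : ∀ n, upCoeff α β γ n ≠ 0)
    (hd : d = x ^ 2 - (1 / 2 - α - β - γ) ^ 2) (hd' : d' = (x + 2) ^ 2 - (1 / 2 - α - β - γ) ^ 2)
    (h : IsSol (upCoeff α β γ) (downCoeff α β γ) d V O) (hV : V 0 = 1) (hO : O 0 = d) :
    shiftV α β γ x d V O 0 = (x - (1 / 2 - α - β - γ)) * ((x + 3 / 2 + α - β - γ) *
      (x + 3 / 2 - α + β - γ) * (x + 3 / 2 - α - β + γ) / 4) ∧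
    shiftO α β γ x d V O 0 = d' * shiftV α β γ x d V O 0 := by
  have h1 : shiftV α β γ x d V O 0 = (x - (1 / 2 - α - β - γ)) * ((x + 3 / 2 + α - β - γ) *
      (x + 3 / 2 - α + β - γ) * (x + 3 / 2 - α - β + γ) / 4) := by
    rw [shiftV, shiftCoeff, hV, hO, hd, Nat.cast_zero]; ring
  refine ⟨h1, ?_⟩
  -- Extended evenly to `N = -1/2`, the solution has backward difference `0` at `n = 0`, and its
  -- image has the same value at `-1/2` and `1/2`.
  rw [shiftV_second_order hA hd hd' h 0 0 (shiftV α β γ x d V O 0) (by rw [hV, hO]; ring) ?_]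
  · ring
  · rw [shiftV, shiftCoeff, shiftCoeff, hV, hO, hd, Nat.cast_zero]; ring

/-- The odd solution is mapped to a multiple of the odd solution. -/
theorem shift_odd (hA : ∀ n, upCoeff α β γ n ≠ 0)
    (hd : d = x ^ 2 - (1 / 2 - α - β - γ) ^ 2) (hd' : d' = (x + 2) ^ 2 - (1 / 2 - α - β - γ) ^ 2)
    (h : IsSol (upCoeff α β γ) (downCoeff α β γ) d V O) (hV : V 0 = d / 2)
    (hO : O 0 = d ^ 2 / 2 + downCoeff α β γ 0 * d) :
    shiftV α β γ x d V O 0 = (x - (1 / 2 - α - β - γ)) * (x + (1 / 2 - α - β - γ)) *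
      (x + 2 + (1 / 2 - α - β - γ)) * ((x + 1 / 2 - α + β + γ) *
      (x + 1 / 2 + α - β + γ) * (x + 1 / 2 + α + β - γ) / 8) ∧
    shiftO α β γ x d V O 0 = (d' + 2 * downCoeff α β γ 0) * shiftV α β γ x d V O 0 := by
  have e := mul_downCoeff α β γ 0
  have e' : (downCoeff α β γ 0 : ℂ) = 2 * ((1 / 2 - α) * (1 / 2 - β) * (1 / 2 - γ)) := by
    push_cast at e
    linear_combination 2 * e
  refine ⟨?_, ?_⟩
  · rw [shiftV, shiftCoeff, hV, hO, e', hd, Nat.cast_zero]; ring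
  -- The odd extension takes the value `-d/2` at `N = -1/2`, so the backward difference is `d`; the
  -- image is odd as well.
  · rw [shiftV_second_order hA hd hd' h 0 d (-shiftV α β γ x d V O 0) (by rw [hV, hO]; ring) ?_]
    · ring
    · rw [shiftV, shiftCoeff, shiftCoeff, hV, hO, e', hd, Nat.cast_zero]; ring

end Shift

/-! ### Even and odd solutions and the ratio of their leading coefficients -/

/-- The solution of the first-order system with prescribed initial values. -/
def solPair (A C : ℕ → ℝ) (d v o : ℂ) : ℕ → ℂ × ℂ
  | 0 => (v, o)
  | n + 1 =>
    ((solPair A C d v o n).1 + (solPair A C d v o n).2 / A n,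
      d * ((solPair A C d v o n).1 + (solPair A C d v o n).2 / A n) +
        C (n + 1) / A n * (solPair A C d v o n).2)

theorem solPair_isSol (A C : ℕ → ℝ) (d v o : ℂ) :
    IsSol A C d (fun n => (solPair A C d v o n).1) (fun n => (solPair A C d v o n).2) :=
  fun _ => ⟨rfl, rfl⟩

/-- The solution attached to the numerators; it is invariant under `N ↦ -N`. -/
def evenSol (A C : ℕ → ℝ) (d : ℂ) : ℕ → ℂ × ℂ := solPair A C d 1 d

/-- The solution attached to the denominators; it changes sign under `N ↦ -N`. -/
def oddSol (A C : ℕ → ℝ) (d : ℂ) : ℕ → ℂ × ℂ := solPair A C d (d / 2) (d ^ 2 / 2 + C 0 * d)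

/-- `c` is the leading coefficient of the solution `S`. -/
def IsLeadCoeff (ρ : ℝ) (x : ℂ) (S : ℕ → ℂ × ℂ) (c : ℂ) : Prop :=
  Tendsto (fun n => (S n).1 / growthFactor (ρ + x) n) atTop (𝓝 c) ∧
  Tendsto (fun n : ℕ => (S n).2 / ((n : ℂ) + 1 / 2) / growthFactor (ρ + x) n) atTop
        (𝓝 ((ρ + x) * c))

/-- `l` is the limit of the quotients `2 * evenSol / oddSol`, in the nondegenerate sense. -/
def HasSolRatio (A C : ℕ → ℝ) (ρ : ℝ) (x l : ℂ) : Prop :=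
  ∃ cP cQ, IsLeadCoeff ρ x (evenSol A C (x ^ 2 - ρ ^ 2)) cP ∧
    IsLeadCoeff ρ x (oddSol A C (x ^ 2 - ρ ^ 2)) cQ ∧ cP ≠ 0 ∧ cQ ≠ 0 ∧ l = 2 * cP / cQ

theorem HasSolRatio.unique {A C : ℕ → ℝ} {ρ : ℝ} {x l l' : ℂ} (h : HasSolRatio A C ρ x l)
    (h' : HasSolRatio A C ρ x l') : l = l' := by
  obtain ⟨p, q, hp, hq, -, -, rfl⟩ := h
  obtain ⟨p', q', hp', hq', -, -, rfl⟩ := h'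
  rw [tendsto_nhds_unique hp.1 hp'.1, tendsto_nhds_unique hq.1 hq'.1]

/-- The initial Casoratian of the even and odd solutions is `C 0 * d`, nonzero because `d ≠ 0`;
hence the two leading coefficients cannot both vanish. -/
theorem QuadraticGrowth.exists_leadCoeffs {A C : ℕ → ℝ} {σ ρ : ℝ} (hg : QuadraticGrowth A C σ)
    (hσ : ρ = 1 / 2 - σ) (hρ : 0 < ρ) {x : ℂ} (hx : 0 < x.re) (hd : x ^ 2 - (ρ : ℂ) ^ 2 ≠ 0) :
    ∃ cP cQ, IsLeadCoeff ρ x (evenSol A C (x ^ 2 - ρ ^ 2)) cP ∧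
      IsLeadCoeff ρ x (oddSol A C (x ^ 2 - ρ ^ 2)) cQ ∧ (cP = 0 → cQ ≠ 0) := by
  obtain ⟨h1, h2⟩ := hg.asymptotics hσ hρ hx
  obtain ⟨cP, hP⟩ := h1 _ _ (solPair_isSol A C (x ^ 2 - ρ ^ 2) 1 (x ^ 2 - ρ ^ 2))
  obtain ⟨cQ, hQ⟩ := h1 _ _ (solPair_isSol A C (x ^ 2 - ρ ^ 2) ((x ^ 2 - ρ ^ 2) / 2)
    ((x ^ 2 - ρ ^ 2) ^ 2 / 2 + C 0 * (x ^ 2 - ρ ^ 2)))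
  refine ⟨cP, cQ, hP, hQ, fun hcP hcQ => ?_⟩
  have hC : (C 0 : ℂ) ≠ 0 := by exact_mod_cast (hg.posC 0).ne'
  refine h2 _ _ _ _ (solPair_isSol A C (x ^ 2 - ρ ^ 2) 1 (x ^ 2 - ρ ^ 2))
    (solPair_isSol A C (x ^ 2 - ρ ^ 2) ((x ^ 2 - ρ ^ 2) / 2)
    ((x ^ 2 - ρ ^ 2) ^ 2 / 2 + C 0 * (x ^ 2 - ρ ^ 2))) ?_ (hcP ▸ hP.1) (hcQ ▸ hQ.1)
  simp only [solPair]
  rw [show 1 * ((x ^ 2 - (ρ : ℂ) ^ 2) ^ 2 / 2 + C 0 * (x ^ 2 - (ρ : ℂ) ^ 2)) -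
    (x ^ 2 - (ρ : ℂ) ^ 2) / 2 * (x ^ 2 - (ρ : ℂ) ^ 2) = C 0 * (x ^ 2 - (ρ : ℂ) ^ 2) by ring]
  exact mul_ne_zero hC hd

theorem tendsto_natCast_add_half_inv :
    Tendsto (fun n : ℕ => 1 / ((n : ℂ) + 1 / 2)) atTop (𝓝 0) := by
  have h1 : Tendsto (fun n : ℕ => ((n : ℝ) + 1 / 2)⁻¹) atTop (𝓝 0) :=
    tendsto_inv_atTop_zero.comp (tendsto_atTop_add_const_right _ _ tendsto_natCast_atTop_atTop)
  have h2 := (Complex.continuous_ofReal.tendsto 0).comp h1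
  rw [Complex.ofReal_zero] at h2
  refine h2.congr fun n => ?_
  simp only [Function.comp]
  push_cast
  rw [one_div, one_div]

/-- The effect of `shiftV` on leading coefficients. -/
theorem IsLeadCoeff.tendsto_shiftV {α β γ ρ : ℝ} {x : ℂ} {S : ℕ → ℂ × ℂ} {c : ℂ}
    (hρ : ρ = 1 / 2 - (α + β + γ)) (h : IsLeadCoeff ρ x S c) (d : ℂ) :
    Tendsto (fun n : ℕ => shiftV α β γ x d (fun n => (S n).1) (fun n => (S n).2) n /
      (((n : ℂ) + 1 / 2) ^ 2 * growthFactor (ρ + x) n)) atTop (𝓝 (4 * x * (x + 1) * c)) := by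
  have hρ' : (1 / 2 - (α : ℂ) - β - γ) = ρ := by rw [hρ]; push_cast; ring
  set e : ℂ := shiftCoeff α β γ x 0 with he
  have hsh : ∀ N : ℂ, shiftCoeff α β γ x N = 2 * (x + 1) * (x - ρ) * N ^ 2 + e := fun N => by
    rw [he, ← hρ']; unfold shiftCoeff; ring
  have hN := tendsto_natCast_add_half_inv
  -- The `V` term contributes `2(x+1)(x-ρ)c` at order `N²` and the `O` term `2(x+1)(x+ρ)c`, which
  -- add up to `4x(x+1)c`.
  have h1 := (((tendsto_const_nhds (x := 2 * (x + 1) * (x - ρ))).add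
    ((hN.pow 2).const_mul e)).sub (hN.const_mul ((x + 1) * d))).mul h.1
  have h2 := h1.add (h.2.const_mul (2 * (x + 1)))
  convert h2 using 1
  · funext n
    have := natCast_add_half_ne_zero n
    simp only [shiftV]
    rw [hsh]
    generalize (n : ℂ) + 1 / 2 = N at *
    by_cases hp : growthFactor (ρ + x) n = 0
    · simp [hp]
    · field_simp
  · congr 1; ring

/-- The quotient of the two solutions at `x` is obtained from the one at `x + 2`. -/
theorem HasSolRatio.of_shift {α β γ ρ : ℝ} (hα : |α| ≤ 1 / 6) (hβ : |β| ≤ 1 / 6) (hγ : |γ| ≤ 1 / 6)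
    (hρ : ρ = 1 / 2 - (α + β + γ)) (hρ0 : 0 < ρ) {x l : ℂ} (hx : 0 < x.re) (hxρ : x ≠ ρ)
    (h : HasSolRatio (upCoeff α β γ) (downCoeff α β γ) ρ (x + 2) l) :
    HasSolRatio (upCoeff α β γ) (downCoeff α β γ) ρ x
      (l * ((x + 2 - ρ) * (x + 3 / 2 + α - β - γ) * (x + 3 / 2 - α + β - γ) *
        (x + 3 / 2 - α - β + γ) / ((x + ρ) * (x + 1 / 2 - α + β + γ) *
          (x + 1 / 2 + α - β + γ) * (x + 1 / 2 + α + β - γ)))) := by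
  obtain ⟨cP', cQ', hP', hQ', hcP', hcQ', rfl⟩ := h
  have hg := quadraticGrowth (α := α) (β := β) (γ := γ) (by linarith) (by linarith) (by linarith)
  have hne : ∀ z : ℂ, 0 < z.re → z ≠ 0 := fun z hz h0 => by simp [h0] at hz
  rw [abs_le] at hα hβ hγ
  have hx0 := hne x hx
  have n0 : x + 1 ≠ 0 := hne _ (by simp; linarith)
  have n1 : x + ρ ≠ 0 := hne _ (by simp; linarith)
  have n2 : x + 2 - ρ ≠ 0 := hne _ (by simp; linarith)
  have n3 : x + 2 + ρ ≠ 0 := hne _ (by simp; linarith)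
  have n4 : x + 3 / 2 + α - β - γ ≠ 0 := hne _ (by simp; linarith)
  have n5 : x + 3 / 2 - α + β - γ ≠ 0 := hne _ (by simp; linarith)
  have n6 : x + 3 / 2 - α - β + γ ≠ 0 := hne _ (by simp; linarith)
  have n7 : x + 1 / 2 - α + β + γ ≠ 0 := hne _ (by simp; linarith)
  have n8 : x + 1 / 2 + α - β + γ ≠ 0 := hne _ (by simp; linarith)
  have n9 : x + 1 / 2 + α + β - γ ≠ 0 := hne _ (by simp; linarith)
  have n10 : x - ρ ≠ 0 := sub_ne_zero.2 hxρ
  have hd0 : x ^ 2 - (ρ : ℂ) ^ 2 ≠ 0 := by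
    rw [sq_sub_sq]; exact mul_ne_zero n1 n10
  obtain ⟨cP, cQ, hP, hQ, hPQ⟩ := hg.exists_leadCoeffs hρ hρ0 hx hd0
  have hρ' : (1 / 2 - (α : ℂ) - β - γ) = ρ := by rw [hρ]; push_cast; ring
  have hA : ∀ n, upCoeff α β γ n ≠ 0 := fun n => (hg.posA n).ne'
  set d := x ^ 2 - (ρ : ℂ) ^ 2 with hd
  set d' := (x + 2) ^ 2 - (ρ : ℂ) ^ 2 with hd'
  have hdρ : d = x ^ 2 - (1 / 2 - (α : ℂ) - β - γ) ^ 2 := by rw [hρ']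
  have hdρ' : d' = (x + 2) ^ 2 - (1 / 2 - (α : ℂ) - β - γ) ^ 2 := by rw [hρ']
  have hPs := solPair_isSol (upCoeff α β γ) (downCoeff α β γ) d 1 d
  have hQs := solPair_isSol (upCoeff α β γ) (downCoeff α β γ) d (d / 2)
    (d ^ 2 / 2 + downCoeff α β γ 0 * d)
  obtain ⟨eP, eP'⟩ := shift_even hA hdρ hdρ' hPs rfl rfl
  obtain ⟨eQ, eQ'⟩ := shift_odd hA hdρ hdρ' hQs rfl rfl
  have tP := hP.tendsto_shiftV hρ d
  have tQ := hQ.tendsto_shiftV hρ d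
  obtain ⟨p, hp⟩ : ∃ p, p = (x - ρ) * ((x + 3 / 2 + α - β - γ) *
      (x + 3 / 2 - α + β - γ) * (x + 3 / 2 - α - β + γ) / 4) := ⟨_, rfl⟩
  -- The initial value from `shift_odd` divided by `d' / 2`, the initial value of the odd solution
  -- at `x + 2`.
  obtain ⟨q, hq⟩ : ∃ q, q = (x - ρ) * (x + ρ) * ((x + 1 / 2 - α + β + γ) *
      (x + 1 / 2 + α - β + γ) * (x + 1 / 2 + α + β - γ) / 4) / (x + 2 - ρ) := ⟨_, rfl⟩
  have hp0 : p ≠ 0 := by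
    rw [hp]
    exact mul_ne_zero n10 (div_ne_zero (mul_ne_zero (mul_ne_zero n4 n5) n6) (by norm_num))
  have hq0 : q ≠ 0 := by
    rw [hq]
    exact div_ne_zero (mul_ne_zero (mul_ne_zero n10 n1)
      (div_ne_zero (mul_ne_zero (mul_ne_zero n7 n8) n9) (by norm_num))) n2
  rw [hρ'] at eP eQ
  have hd'f : d' = (x + 2 + ρ) * (x + 2 - ρ) := by rw [hd']; ring
  have hSP : ∀ n, shiftV α β γ x d (fun n => (evenSol (upCoeff α β γ) (downCoeff α β γ) d n).1)
      (fun n => (evenSol (upCoeff α β γ) (downCoeff α β γ) d n).2) n =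
      p * (evenSol (upCoeff α β γ) (downCoeff α β γ) d' n).1 := by
    intro n
    have hs' := solPair_isSol (upCoeff α β γ) (downCoeff α β γ) d' 1 d'
    have := ((shift_isSol hA hdρ hdρ' hPs).ext (hs'.combine hs' p 0)
      (by rw [eP]; simp [solPair, hp]) (by rw [eP', eP]; simp [solPair, hp]; ring) n).1
    rw [zero_mul, add_zero] at this
    exact this
  have hSQ : ∀ n, shiftV α β γ x d (fun n => (oddSol (upCoeff α β γ) (downCoeff α β γ) d n).1)
      (fun n => (oddSol (upCoeff α β γ) (downCoeff α β γ) d n).2) n =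
      q * (oddSol (upCoeff α β γ) (downCoeff α β γ) d' n).1 := by
    intro n
    have hs' := solPair_isSol (upCoeff α β γ) (downCoeff α β γ) d' (d' / 2)
      (d' ^ 2 / 2 + downCoeff α β γ 0 * d')
    have := ((shift_isSol hA hdρ hdρ' hQs).ext (hs'.combine hs' q 0)
      (by
        rw [eQ]; simp only [solPair, hq, hd'f]; field_simp; ring)
      (by
        rw [eQ', eQ]; simp only [solPair, hq, hd'f]; field_simp; ring) n).1
    rw [zero_mul, add_zero] at this
    exact this
  have key : p * cP' * (4 * x * (x + 1) * cQ) = 4 * x * (x + 1) * cP * (q * cQ') := by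
    refine tendsto_nhds_unique ((hP'.1.const_mul p).mul tQ)
      ((tP.mul (hQ'.1.const_mul q)).congr fun n => ?_)
    rw [hSP, hSQ]
    ring
  have key' : p * cP' * cQ = cP * q * cQ' := by
    have : 4 * x * (x + 1) ≠ 0 := mul_ne_zero (mul_ne_zero (by norm_num) hx0) n0
    refine mul_left_cancel₀ this ?_
    linear_combination key
  -- Nonvanishing descends from `x + 2` to `x`: by `key'`, if either of `cP`, `cQ` were zero then
  -- both would be, against independence.
  have hcP : cP ≠ 0 := fun h0 => by
    rw [h0, zero_mul, zero_mul] at key'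
    exact mul_ne_zero (mul_ne_zero hp0 hcP') (hPQ h0) key'
  have hcQ : cQ ≠ 0 := fun h0 => by
    rw [h0, mul_zero] at key'
    exact mul_ne_zero (mul_ne_zero hcP hq0) hcQ' key'.symm
  refine ⟨cP, cQ, hP, hQ, hcP, hcQ, ?_⟩
  have hl : 2 * cP / cQ = 2 * cP' / cQ' * (p / q) := by
    rw [div_mul_div_comm, div_eq_div_iff hcQ (mul_ne_zero hcQ' hq0)]
    linear_combination -2 * key'
  rw [hl, hp, hq]
  congr 1
  clear * - n1 n2 n7 n8 n9 n10
  generalize x + 3 / 2 + α - β - γ = y₁ at *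
  generalize x + 3 / 2 - α + β - γ = y₂ at *
  generalize x + 3 / 2 - α - β + γ = y₃ at *
  generalize x + 1 / 2 - α + β + γ = z₁ at *
  generalize x + 1 / 2 + α - β + γ = z₂ at *
  generalize x + 1 / 2 + α + β - γ = z₃ at *
  generalize x - ρ = u at *
  generalize x + ρ = v at *
  generalize x + 2 - ρ = w at *
  field_simp

/-! ### The ratio for large real part of `d` -/

/-- For `0 < re d` the tails of the continued fraction stay in the right half-plane. -/
theorem norm_combination_le {A C : ℕ → ℝ} (hA : ∀ n, 0 < A n) (hC : ∀ n, 0 < C n) {d : ℂ}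
    (hd : 0 < d.re) {V O V' O' : ℕ → ℂ} (h : IsSol A C d V O) (h' : IsSol A C d V' O') {K : ℝ}
    (h0 : ∀ w : ℂ, 0 ≤ w.re → ‖O' 0 + w * V' 0‖ ≤ K * ‖O 0 + w * V 0‖) (n : ℕ) :
    ∀ w : ℂ, 0 ≤ w.re → ‖O' n + w * V' n‖ ≤ K * ‖O n + w * V n‖ := by
  induction n with
  | zero => exact h0
  | succ n ih =>
    intro w hw
    have hAn := hA n
    have hA0 : (A n : ℂ) ≠ 0 := by exact_mod_cast hAn.ne'
    have hre : 0 < (d + w + C (n + 1)).re := by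
      have := hC (n + 1)
      simp; linarith
    have hre2 : 0 < (d + w).re := by simp; linarith
    have hs : d + w + C (n + 1) ≠ 0 := fun h0 => by rw [h0] at hre; simp at hre
    have hs2 : d + w ≠ 0 := fun h0 => by rw [h0] at hre2; simp at hre2
    -- One step backwards turns the functional `O + w * V` into a multiple of `O + w' * V`, by a
    -- Möbius map preserving the right half-plane. The multiple is the same for both solutions, so
    -- the inequality is inherited.
    set w' : ℂ := A n * (d + w) / (d + w + C (n + 1)) with hw'
    have hw're : 0 ≤ w'.re := by
      rw [hw', mul_div_assoc, Complex.re_ofReal_mul]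
      refine mul_nonneg hAn.le ?_
      have e : (d + w) / (d + w + C (n + 1)) = 1 - C (n + 1) * (d + w + C (n + 1))⁻¹ := by
        field_simp; ring
      rw [Complex.div_re, ← add_div]
      refine div_nonneg ?_ (Complex.normSq_nonneg _)
      have := hC (n + 1)
      have i : (d + w + C (n + 1)).im = (d + w).im := by simp
      rw [i]
      nlinarith [mul_self_nonneg (d + w).im, mul_pos hre hre2]
    have key : ∀ V O, IsSol A C d V O → O (n + 1) + w * V (n + 1) =
        (d + w + C (n + 1)) / A n * (O n + w' * V n) := by
      intro V O h
      rw [(h n).2, (h n).1, hw']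
      field_simp
      ring
    rw [key V O h, key V' O' h', norm_mul, norm_mul, mul_left_comm]
    exact mul_le_mul_of_nonneg_left (ih w' hw're) (norm_nonneg _)

/-- For large `re d` the quotient of the solutions is close to `4 / d`. -/
theorem QuadraticGrowth.exists_hasSolRatio {A C : ℕ → ℝ} {σ ρ : ℝ} (hg : QuadraticGrowth A C σ)
    (hσ : ρ = 1 / 2 - σ) (hρ : 0 < ρ) {x : ℂ} (hx : 0 < x.re)
    (hd : 2 * C 0 < (x ^ 2 - (ρ : ℂ) ^ 2).re) :
    ∃ l, HasSolRatio A C ρ x l ∧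
      ‖4 / ((x ^ 2 - (ρ : ℂ) ^ 2) * l) - 1‖ ≤ 2 * C 0 / (x ^ 2 - (ρ : ℂ) ^ 2).re := by
  have hC0 := hg.posC 0
  set d := x ^ 2 - (ρ : ℂ) ^ 2 with hdd
  have hdre : 0 < d.re := by linarith
  have hd0 : d ≠ 0 := fun h => by rw [h] at hdre; simp at hdre
  have hdn : 0 < ‖d‖ := norm_pos_iff.2 hd0
  obtain ⟨cP, cQ, hP, hQ, hPQ⟩ := hg.exists_leadCoeffs hσ hρ hx hd0
  have hPs := solPair_isSol A C d 1 d
  have hQs := solPair_isSol A C d (d / 2) (d ^ 2 / 2 + C 0 * d)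
  have hU := hQs.combine hPs 1 (-(d / 2))
  -- The solution `Q - (d/2) P` starts at `(0, C 0 * d)`, while `‖d + w‖ ≥ Re d` for `Re w ≥ 0`. The
  -- estimate at `w = 0` passes to leading coefficients and shows that `cQ` is close to `(d/2) cP`.
  set K := C 0 * ‖d‖ / d.re with hK
  have hb := norm_combination_le hg.posA hg.posC hdre hPs hU (K := K) (by
    intro w hw
    simp only [solPair]
    rw [show 1 * (d ^ 2 / 2 + C 0 * d) + -(d / 2) * d + w * (1 * (d / 2) + -(d / 2) * 1) =
      C 0 * d by ring, norm_mul, Complex.norm_real, Real.norm_eq_abs, abs_of_pos hC0, hK]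
    have h1 : d.re ≤ ‖d + w * 1‖ := by
      refine le_trans ?_ (Complex.re_le_norm _)
      simp; exact hw
    rw [div_mul_eq_mul_div, le_div_iff₀ hdre]
    gcongr)
  have hμ : (ρ : ℂ) + x ≠ 0 := fun h => by
    have : ((ρ : ℂ) + x).re = 0 := by rw [h]; simp
    simp at this; linarith
  have hle : ‖cQ - d / 2 * cP‖ ≤ K * ‖cP‖ := by
    have hO := (hQ.2.sub (hP.2.const_mul (d / 2))).norm
    have hO' := hP.2.norm.const_mul K
    have := le_of_tendsto_of_tendsto' hO hO' fun n => by
      have h1 := hb n 0 le_rfl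
      simp only [zero_mul, add_zero] at h1
      have e : (oddSol A C d n).2 / ((n : ℂ) + 1 / 2) / growthFactor (ρ + x) n -
          d / 2 * ((evenSol A C d n).2 / ((n : ℂ) + 1 / 2) / growthFactor (ρ + x) n) =
          (1 * (oddSol A C d n).2 + -(d / 2) * (evenSol A C d n).2) / ((n : ℂ) + 1 / 2) /
            growthFactor (ρ + x) n := by ring
      rw [e, norm_div, norm_div, norm_div, norm_div, ← mul_div_assoc, ← mul_div_assoc]
      gcongr
      exact h1
    rw [show (ρ + x) * cQ - d / 2 * ((ρ + x) * cP) = (ρ + x) * (cQ - d / 2 * cP) by ring,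
      norm_mul, norm_mul, mul_left_comm] at this
    exact le_of_mul_le_mul_left this (norm_pos_iff.2 hμ)
  have hcP : cP ≠ 0 := fun h0 => by
    refine hPQ h0 (norm_le_zero_iff.1 ?_)
    simpa [h0] using hle
  have hcPn : 0 < ‖cP‖ := norm_pos_iff.2 hcP
  have hbound : ‖cQ / cP / (d / 2) - 1‖ ≤ 2 * C 0 / d.re := by
    have e : cQ / cP / (d / 2) - 1 = (cQ - d / 2 * cP) / (cP * (d / 2)) := by field_simp
    rw [e, norm_div, div_le_iff₀ (by rw [norm_mul]; simp; positivity)]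
    refine hle.trans (le_of_eq ?_)
    rw [norm_mul, norm_div, hK]
    simp
    field_simp
  have hcQ : cQ ≠ 0 := fun h0 => by
    rw [h0] at hbound
    simp only [zero_div, zero_sub, norm_neg, norm_one] at hbound
    rw [le_div_iff₀ hdre] at hbound
    linarith
  refine ⟨2 * cP / cQ, ⟨cP, cQ, hP, hQ, hcP, hcQ, rfl⟩, ?_⟩
  rw [show 4 / (d * (2 * cP / cQ)) = cQ / cP / (d / 2) by field_simp; norm_num]
  exact hbound

/-! ### From the difference equation to the approximants -/

theorem eventually_of_odd_of_even {P : ℕ → Prop} (h₁ : ∀ᶠ n in atTop, P (2 * n + 1))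
    (h₂ : ∀ᶠ n in atTop, P (2 * n + 2)) : ∀ᶠ n in atTop, P n := by
  obtain ⟨a, ha⟩ := eventually_atTop.1 h₁
  obtain ⟨b, hb⟩ := eventually_atTop.1 h₂
  refine eventually_atTop.2 ⟨2 * (a + b) + 2, fun n hn => ?_⟩
  rcases Nat.even_or_odd' n with ⟨k, rfl | rfl⟩
  · obtain ⟨k, rfl⟩ : ∃ j, k = j + 1 := ⟨k - 1, by omega⟩
    exact hb k (by omega)
  · exact ha k (by omega)

/-- Two-step recurrences of the approximants in terms of the first-order system. -/
theorem approximants_eq {A C : ℕ → ℝ} (hA : ∀ n, 0 < A n) {d : ℂ} {X V O : ℕ → ℂ}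
    (hodd : ∀ n, X (2 * n + 3) = d * X (2 * n + 2) + A n * X (2 * n + 1))
    (heven : ∀ n, X (2 * n + 4) = X (2 * n + 3) + C (n + 1) * X (2 * n + 2))
    (h : IsSol A C d V O) (hV : X 1 = V 0) (hO : d * X 2 = O 0) (n : ℕ) :
    X (2 * n + 1) = (∏ k ∈ Finset.range n, (A k : ℂ)) * V n ∧
      d * X (2 * n + 2) = (∏ k ∈ Finset.range n, (A k : ℂ)) * O n := by
  induction n with
  | zero => simp [hV, hO]
  | succ n ih =>
    have hA0 : (A n : ℂ) ≠ 0 := by exact_mod_cast (hA n).ne'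
    have h1 : X (2 * (n + 1) + 1) = (∏ k ∈ Finset.range (n + 1), (A k : ℂ)) * V (n + 1) := by
      rw [show 2 * (n + 1) + 1 = 2 * n + 3 by ring, hodd, ih.1, ih.2, (h n).1,
        Finset.prod_range_succ]
      field_simp
      ring
    refine ⟨h1, ?_⟩
    rw [show 2 * (n + 1) + 1 = 2 * n + 3 by ring] at h1
    rw [show 2 * (n + 1) + 2 = 2 * n + 4 by ring, heven, h1, mul_add, mul_left_comm d (C (n + 1) : ℂ),
      ih.2, (h n).2, Finset.prod_range_succ]
    field_simp

/-- Odd-indexed approximants are quotients of the `V` components and even-indexed ones of the `O`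
components. Both have the same limit because the leading coefficient of `O / N` is `ρ + x` times
that of `V` for either solution. -/
theorem contFractConvergesTo_of_hasSolRatio {A C : ℕ → ℝ} (hA : ∀ n, 0 < A n) {ρ : ℝ} (hρ : 0 < ρ)
    {x l : ℂ} (hx : 0 < x.re) (hd : x ^ 2 - (ρ : ℂ) ^ 2 ≠ 0) {a : ℕ → ℂ}
    (ha_odd : ∀ n, a (2 * n + 1) = C n) (ha_even : ∀ n, a (2 * n + 2) = A n)
    (h : HasSolRatio A C ρ x l) :
    ContFractConvergesTo (alternatingContFract (x ^ 2 - ρ ^ 2) a) l := by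
  obtain ⟨cP, cQ, hP, hQ, hcP, hcQ, rfl⟩ := h
  set d := x ^ 2 - (ρ : ℂ) ^ 2
  set g := alternatingContFract d a with hg
  have hs0 : g.s.get? 0 = some ⟨2, d / 2⟩ := rfl
  have hsodd : ∀ n, g.s.get? (2 * n + 1) = some ⟨C n, 1⟩ := fun n => by
    change some (if 2 * n + 1 = 0 then (⟨2, d / 2⟩ : GenContFract.Pair ℂ) else
      if Even (2 * n + 1) then ⟨a (2 * n + 1), d⟩ else ⟨a (2 * n + 1), 1⟩) = _
    rw [if_neg (by omega), if_neg (by simp), ha_odd]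
  have hseven : ∀ n, g.s.get? (2 * n + 2) = some ⟨A n, d⟩ := fun n => by
    change some (if 2 * n + 2 = 0 then (⟨2, d / 2⟩ : GenContFract.Pair ℂ) else
      if Even (2 * n + 2) then ⟨a (2 * n + 2), d⟩ else ⟨a (2 * n + 2), 1⟩) = _
    rw [if_neg (by omega), if_pos (by simp [parity_simps]), ha_even]
  have n0 : g.nums 0 = 0 := by simp [hg, alternatingContFract]
  have d0 : g.dens 0 = 1 := by simp
  have n1 : g.nums 1 = 2 := by
    rw [GenContFract.first_num_eq hs0]; simp [hg, alternatingContFract]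
  have d1 : g.dens 1 = d / 2 := by rw [GenContFract.first_den_eq hs0]
  have hnodd : ∀ n, g.nums (2 * n + 3) = d * g.nums (2 * n + 2) + A n * g.nums (2 * n + 1) :=
    fun n => GenContFract.nums_recurrence (hseven n) rfl rfl
  have hdodd : ∀ n, g.dens (2 * n + 3) = d * g.dens (2 * n + 2) + A n * g.dens (2 * n + 1) :=
    fun n => GenContFract.dens_recurrence (hseven n) rfl rfl
  have hneven : ∀ n, g.nums (2 * n + 2) = g.nums (2 * n + 1) + C n * g.nums (2 * n) :=
    fun n => (GenContFract.nums_recurrence (hsodd n) rfl rfl).trans (by rw [one_mul])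
  have hdeven : ∀ n, g.dens (2 * n + 2) = g.dens (2 * n + 1) + C n * g.dens (2 * n) :=
    fun n => (GenContFract.dens_recurrence (hsodd n) rfl rfl).trans (by rw [one_mul])
  have n2 : g.nums 2 = 2 := by rw [hneven 0, mul_zero, n0, n1]; ring
  have d2 : g.dens 2 = d / 2 + C 0 := by rw [hdeven 0, mul_zero, d0, d1]; ring
  have hPs := solPair_isSol A C d 1 d
  have hQs := solPair_isSol A C d (d / 2) (d ^ 2 / 2 + C 0 * d)
  have hN := approximants_eq hA hnodd (fun n => hneven (n + 1)) (hPs.combine hPs 2 0)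
    (by rw [n1]; simp [solPair]) (by rw [n2]; simp [solPair]; ring)
  have hD := approximants_eq hA hdodd (fun n => hdeven (n + 1)) hQs
    (by rw [d1]; simp [solPair]) (by rw [d2]; simp [solPair]; ring)
  have hprod : ∀ n, (∏ k ∈ Finset.range n, (A k : ℂ)) ≠ 0 := fun n =>
    Finset.prod_ne_zero_iff.2 fun k _ => by exact_mod_cast (hA k).ne'
  have hre : 0 < ((ρ : ℂ) + x).re := by simp; linarith
  have hμ : (ρ : ℂ) + x ≠ 0 := fun h => by rw [h] at hre; simp at hre
  have hgr := growthFactor_ne_zero hre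
  refine ⟨eventually_of_odd_of_even ?_ ?_, ?_⟩
  · filter_upwards [hQ.1.eventually_ne hcQ] with n hn
    rw [(hD n).1]
    exact mul_ne_zero (hprod n) fun h0 => hn (by simp only [oddSol, h0, zero_div])
  · filter_upwards [hQ.2.eventually_ne (mul_ne_zero hμ hcQ)] with n hn
    refine right_ne_zero_of_mul (a := d) ?_
    rw [(hD n).2]
    exact mul_ne_zero (hprod n) fun h0 => hn (by simp only [oddSol, h0, zero_div])
  · have t1 : Tendsto (fun n => g.nums (2 * n + 1) / g.dens (2 * n + 1)) atTop
        (𝓝 (2 * cP / cQ)) := by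
      refine ((hP.1.const_mul 2).div hQ.1 hcQ).congr fun n => ?_
      have e1 : g.nums (2 * n + 1) = (∏ k ∈ Finset.range n, (A k : ℂ)) *
        (2 * (evenSol A C d n).1 + 0 * (evenSol A C d n).1) := (hN n).1
      have e2 : g.dens (2 * n + 1) = (∏ k ∈ Finset.range n, (A k : ℂ)) * (oddSol A C d n).1 :=
        (hD n).1
      simp only [Pi.div_apply]
      rw [e1, e2, mul_div_mul_left _ _ (hprod n), ← mul_div_assoc, div_div_div_cancel_right₀ (hgr n),
        zero_mul, add_zero]
    have t2 : Tendsto (fun n => g.nums (2 * n + 2) / g.dens (2 * n + 2)) atTop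
        (𝓝 (2 * cP / cQ)) := by
      have h := (hP.2.const_mul 2).div hQ.2 (mul_ne_zero hμ hcQ)
      rw [mul_left_comm, mul_div_mul_left _ _ hμ] at h
      refine h.congr fun n => ?_
      have e1 : d * g.nums (2 * n + 2) = (∏ k ∈ Finset.range n, (A k : ℂ)) *
        (2 * (evenSol A C d n).2 + 0 * (evenSol A C d n).2) := (hN n).2
      have e2 : d * g.dens (2 * n + 2) = (∏ k ∈ Finset.range n, (A k : ℂ)) * (oddSol A C d n).2 :=
        (hD n).2
      simp only [Pi.div_apply]
      rw [← mul_div_mul_left (g.nums (2 * n + 2)) (g.dens (2 * n + 2)) hd, e1, e2, mul_div_mul_left _ _ (hprod n), ← mul_div_assoc,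
        div_div_div_cancel_right₀ (hgr n), ← mul_div_assoc,
        div_div_div_cancel_right₀ (natCast_add_half_ne_zero n), zero_mul, add_zero]
    exact fun s hs => eventually_of_odd_of_even (t1 hs) (t2 hs)

/-! ### Evaluation by the Gamma function -/

/-- The limit of the product that arises from iterating the functional equation. -/
theorem tendsto_prod_gamma {x : ℂ} (hx : 0 < x.re) (ρ : ℝ) :
    Tendsto (fun k : ℕ => 4 / ((x + 2 * k) ^ 2 - (ρ : ℂ) ^ 2) *
      ∏ j ∈ Finset.range k, ((x + 2 * j + 5 / 3) / (x + 2 * j + 1 / 3)) ^ 3) atTop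
      (𝓝 (Complex.Gamma ((x + 1 / 3) / 2) ^ 3 / Complex.Gamma ((x + 5 / 3) / 2) ^ 3)) := by
  -- `Complex.GammaSeq s n` has `n + 1` factors in its denominator, so the product is taken up to `n
  -- + 1`.
  rw [← tendsto_add_atTop_iff_nat 1]
  have hΓ : Complex.Gamma ((x + 5 / 3) / 2) ^ 3 ≠ 0 := by
    refine pow_ne_zero _ (Complex.Gamma_ne_zero_of_re_pos ?_)
    rw [show (x + 5 / 3) / 2 = ((1 / 2 : ℝ) : ℂ) * (x + ((5 / 3 : ℝ) : ℂ)) by push_cast; ring,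
      Complex.re_ofReal_mul, Complex.add_re, Complex.ofReal_re]
    linarith
  have h1 := ((Complex.GammaSeq_tendsto_Gamma ((x + 1 / 3) / 2)).pow 3).div
    ((Complex.GammaSeq_tendsto_Gamma ((x + 5 / 3) / 2)).pow 3) hΓ
  have hinv : Tendsto (fun n : ℕ => 1 / (n : ℂ)) atTop (𝓝 0) := by
    simpa using tendsto_inv_atTop_nhds_zero_nat (𝕜 := ℂ)
  have h2 : Tendsto (fun n : ℕ => 1 / ((1 + (x / 2 + 1) * (1 / (n : ℂ))) ^ 2 -
      (ρ : ℂ) ^ 2 / 4 * (1 / (n : ℂ)) ^ 2)) atTop (𝓝 1) := by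
    have := (((tendsto_const_nhds (x := (1 : ℂ))).add (hinv.const_mul (x / 2 + 1))).pow 2).sub
      ((hinv.pow 2).const_mul ((ρ : ℂ) ^ 2 / 4))
    have := this.inv₀ (by norm_num)
    simpa using this
  have h3 := h1.mul h2
  rw [mul_one] at h3
  refine h3.congr' ?_
  filter_upwards [eventually_ge_atTop 1] with n hn
  have hn0 : (n : ℂ) ≠ 0 := by exact_mod_cast (by omega : n ≠ 0)
  have hf : ((n.factorial : ℕ) : ℂ) ≠ 0 := by exact_mod_cast n.factorial_ne_zero
  have hne : ∀ r : ℝ, 0 < r → ∀ j : ℕ, x + 2 * j + r ≠ 0 := fun r hr j h0 => by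
    have : (x + 2 * j + r).re = 0 := by rw [h0]; simp
    simp at this
    have := j.cast_nonneg (α := ℝ)
    linarith
  have hprod : ∏ j ∈ Finset.range (n + 1), ((x + 2 * j + 5 / 3) / (x + 2 * j + 1 / 3)) ^ 3 =
      ((∏ j ∈ Finset.range (n + 1), ((x + 5 / 3) / 2 + (j : ℂ))) /
        ∏ j ∈ Finset.range (n + 1), ((x + 1 / 3) / 2 + (j : ℂ))) ^ 3 := by
    rw [Finset.prod_pow, ← Finset.prod_div_distrib]
    congr 1
    refine Finset.prod_congr rfl fun j _ => ?_
    rw [show x + 2 * (j : ℂ) + 5 / 3 = 2 * ((x + 5 / 3) / 2 + j) by ring,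
      show x + 2 * (j : ℂ) + 1 / 3 = 2 * ((x + 1 / 3) / 2 + j) by ring,
      mul_div_mul_left _ _ two_ne_zero]
  have hp1 : ∏ j ∈ Finset.range (n + 1), ((x + 1 / 3) / 2 + (j : ℂ)) ≠ 0 :=
    Finset.prod_ne_zero_iff.2 fun j _ h0 => hne (1 / 3) (by norm_num) j (by
      push_cast; linear_combination 2 * h0)
  have hp2 : ∏ j ∈ Finset.range (n + 1), ((x + 5 / 3) / 2 + (j : ℂ)) ≠ 0 :=
    Finset.prod_ne_zero_iff.2 fun j _ h0 => hne (5 / 3) (by norm_num) j (by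
      push_cast; linear_combination 2 * h0)
  -- The two Gamma arguments differ by `2/3`, so the cubed powers differ by `n²`, matching the
  -- quadratic growth of `d`.
  have hpow : ((n : ℂ) ^ ((x + 5 / 3) / 2)) ^ 3 = ((n : ℂ) ^ ((x + 1 / 3) / 2)) ^ 3 * n ^ 2 := by
    rw [← Complex.cpow_nat_mul, ← Complex.cpow_nat_mul, ← Complex.cpow_natCast (n : ℂ) 2,
      ← Complex.cpow_add _ _ hn0]
    congr 1
    push_cast
    ring
  have hpow0 : (n : ℂ) ^ ((x + 1 / 3) / 2) ≠ 0 := by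
    rw [Complex.cpow_def_of_ne_zero hn0]; exact Complex.exp_ne_zero _
  simp only [Pi.div_apply, Complex.GammaSeq]
  rw [hprod]
  have hden : (x + 2 * ((n + 1 : ℕ) : ℂ)) ^ 2 - (ρ : ℂ) ^ 2 = 4 * (n : ℂ) ^ 2 *
      ((1 + (x / 2 + 1) * (1 / (n : ℂ))) ^ 2 - (ρ : ℂ) ^ 2 / 4 * (1 / (n : ℂ)) ^ 2) := by
    push_cast
    field_simp
    ring
  rw [hden]
  generalize (1 + (x / 2 + 1) * (1 / (n : ℂ))) ^ 2 - (ρ : ℂ) ^ 2 / 4 * (1 / (n : ℂ)) ^ 2 = D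
  rw [div_pow, div_pow, div_pow, mul_pow, mul_pow, hpow]
  generalize (n : ℂ) ^ ((x + 1 / 3) / 2) = w at *
  generalize ∏ j ∈ Finset.range (n + 1), ((x + 1 / 3) / 2 + (j : ℂ)) = p₁ at *
  generalize ∏ j ∈ Finset.range (n + 1), ((x + 5 / 3) / 2 + (j : ℂ)) = p₂ at *
  by_cases hD : D = 0
  · simp [hD]
  · field_simp

/-- For every large `k` the ratio at `x` equals the ratio at `x + 2k` times the same finite product,
and the ratio at `x + 2k` is asymptotic to `4 / d`. `hfac` says that the factor of the functional
equation is the cube whose product gives the Gamma quotient. -/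
theorem hasSolRatio_gamma {α β γ ρ : ℝ} (hα : |α| ≤ 1 / 6) (hβ : |β| ≤ 1 / 6) (hγ : |γ| ≤ 1 / 6)
    (hρ : ρ = 1 / 2 - (α + β + γ)) (hρ0 : 0 < ρ) {x : ℂ} (hx : 0 < x.re) (hxρ : x ≠ ρ)
    (hfac : ∀ y : ℂ, 0 < y.re → (y + 2 - ρ) * (y + 3 / 2 + α - β - γ) * (y + 3 / 2 - α + β - γ) *
        (y + 3 / 2 - α - β + γ) / ((y + ρ) * (y + 1 / 2 - α + β + γ) *
          (y + 1 / 2 + α - β + γ) * (y + 1 / 2 + α + β - γ)) = ((y + 5 / 3) / (y + 1 / 3)) ^ 3) :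
    HasSolRatio (upCoeff α β γ) (downCoeff α β γ) ρ x
      (Complex.Gamma ((x + 1 / 3) / 2) ^ 3 / Complex.Gamma ((x + 5 / 3) / 2) ^ 3) := by
  have hg := quadraticGrowth (α := α) (β := β) (γ := γ) (by linarith) (by linarith) (by linarith)
  have hre : ∀ k : ℕ, 0 < (x + 2 * k).re := fun k => by
    have := k.cast_nonneg (α := ℝ)
    simp; linarith
  have hne : ∀ k : ℕ, x + 2 * k ≠ ρ := fun k h => by
    rcases k.eq_zero_or_pos with rfl | hk
    · exact hxρ (by simpa using h)
    · have h1 : (x + 2 * k).re = ρ := by rw [h]; simp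
      have h2 : (1 : ℝ) ≤ k := by exact_mod_cast hk
      rw [abs_le] at hα hβ hγ
      simp at h1
      linarith
  have hiter : ∀ k : ℕ, ∀ l, HasSolRatio (upCoeff α β γ) (downCoeff α β γ) ρ (x + 2 * k) l →
      HasSolRatio (upCoeff α β γ) (downCoeff α β γ) ρ x
        (l * ∏ j ∈ Finset.range k, ((x + 2 * j + 5 / 3) / (x + 2 * j + 1 / 3)) ^ 3) := by
    intro k
    induction k with
    | zero => intro l h; simpa using h
    | succ k ih =>
      intro l h
      rw [show x + 2 * ((k + 1 : ℕ) : ℂ) = x + 2 * k + 2 by push_cast; ring] at h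
      have h' := ih _ (h.of_shift hα hβ hγ hρ hρ0 (hre k) (hne k))
      rwa [hfac _ (hre k), mul_assoc, mul_comm (_ ^ 3), ← Finset.prod_range_succ] at h'
  have hdre : Tendsto (fun k : ℕ => ((x + 2 * k) ^ 2 - (ρ : ℂ) ^ 2).re) atTop atTop := by
    have h1 : Tendsto (fun k : ℕ => (k : ℝ) - x.im ^ 2 - ρ ^ 2) atTop atTop :=
      tendsto_atTop_add_const_right _ _ (tendsto_atTop_add_const_right _ _
        tendsto_natCast_atTop_atTop)
    refine tendsto_atTop_mono (fun k => ?_) h1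
    have e : ((x + 2 * k) ^ 2 - (ρ : ℂ) ^ 2).re = (x.re + 2 * k) ^ 2 - x.im ^ 2 - ρ ^ 2 := by
      simp [pow_two]
    rw [e]
    have h0 : (k : ℝ) ≤ (k : ℝ) ^ 2 := by exact_mod_cast Nat.le_self_pow two_ne_zero k
    nlinarith [mul_nonneg hx.le (k.cast_nonneg (α := ℝ)), sq_nonneg x.re]
  have hev : ∀ᶠ k : ℕ in atTop, ∃ l,
      HasSolRatio (upCoeff α β γ) (downCoeff α β γ) ρ (x + 2 * k) l ∧
      ‖4 / (((x + 2 * k) ^ 2 - (ρ : ℂ) ^ 2) * l) - 1‖ ≤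
        2 * downCoeff α β γ 0 / ((x + 2 * k) ^ 2 - (ρ : ℂ) ^ 2).re := by
    filter_upwards [hdre.eventually_gt_atTop (2 * downCoeff α β γ 0)] with k hk
    exact hg.exists_hasSolRatio hρ hρ0 (hre k) hk
  obtain ⟨k₀, l₀, h₀, -⟩ := hev.exists
  have hl := hiter k₀ l₀ h₀
  set l := l₀ * ∏ j ∈ Finset.range k₀, ((x + 2 * j + 5 / 3) / (x + 2 * j + 1 / 3)) ^ 3
  suffices hlim : Tendsto (fun k : ℕ => 4 / ((x + 2 * k) ^ 2 - (ρ : ℂ) ^ 2) *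
      ∏ j ∈ Finset.range k, ((x + 2 * j + 5 / 3) / (x + 2 * j + 1 / 3)) ^ 3) atTop (𝓝 l) by
    rwa [← tendsto_nhds_unique hlim (tendsto_prod_gamma hx ρ)]
  rw [tendsto_iff_norm_sub_tendsto_zero]
  have hbound : Tendsto (fun k : ℕ => ‖l‖ * (2 * downCoeff α β γ 0 /
      ((x + 2 * k) ^ 2 - (ρ : ℂ) ^ 2).re)) atTop (𝓝 0) := by
    simpa using (hdre.const_div_atTop (2 * downCoeff α β γ 0)).const_mul ‖l‖
  refine squeeze_zero' (Eventually.of_forall fun _ => norm_nonneg _) ?_ hbound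
  filter_upwards [hev] with k hk
  obtain ⟨lk, hlk, hb⟩ := hk
  have hlk0 : lk ≠ 0 := by
    obtain ⟨p, q, -, -, hp, hq, rfl⟩ := hlk
    exact div_ne_zero (mul_ne_zero two_ne_zero hp) hq
  -- Ratios obtained by descending from different `k` agree, so `l` does not depend on `k` and the
  -- relative error is the one at `x + 2k`.
  have e := hl.unique (hiter k lk hlk)
  generalize (∏ j ∈ Finset.range k, ((x + 2 * j + 5 / 3) / (x + 2 * j + 1 / 3)) ^ 3) = Φ at e ⊢
  have : 4 / ((x + 2 * k) ^ 2 - (ρ : ℂ) ^ 2) * Φ - l =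
      l * (4 / (((x + 2 * k) ^ 2 - (ρ : ℂ) ^ 2) * lk) - 1) := by
    rw [e, div_mul_eq_div_div]
    field_simp
  rw [this, norm_mul]
  gcongr

end

/-! ### The two choices of parameters -/

theorem corollary1 (κ ν : ℕ → ℂ)
    (hκ_even : ∀ m : ℕ, 1 ≤ m →
      κ (2 * m) = 2 * (3 * (m : ℂ) - 2) * (3 * (m : ℂ) - 1) ^ 2 / (27 * (2 * (m : ℂ) - 1)))
    (hκ_odd : ∀ m : ℕ, 1 ≤ m →
      κ (2 * m - 1) = 2 * (3 * (m : ℂ) - 1) * (3 * (m : ℂ) - 2) ^ 2 / (27 * (2 * (m : ℂ) - 1)))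
    (hν_even : ∀ m : ℕ, 1 ≤ m →
      ν (2 * m) = 2 * (3 * (m : ℂ) - 2) ^ 3 / (27 * (2 * (m : ℂ) - 1)))
    (hν_odd : ∀ m : ℕ, 1 ≤ m →
      ν (2 * m - 1) = 2 * (3 * (m : ℂ) - 1) ^ 3 / (27 * (2 * (m : ℂ) - 1)))
    (x : ℂ) (hx : 0 < x.re) :
    (x ≠ 1 / 3 → ContFractConvergesTo (alternatingContFract (x ^ 2 - 1 / 9) κ)
      (Complex.Gamma ((x + 1 / 3) / 2) ^ 3 / Complex.Gamma ((x + 5 / 3) / 2) ^ 3)) ∧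
    (x ≠ 1 → ContFractConvergesTo (alternatingContFract (x ^ 2 - 1) ν)
      (Complex.Gamma ((x + 1 / 3) / 2) ^ 3 / Complex.Gamma ((x + 5 / 3) / 2) ^ 3)) := by
  have hcast : ∀ n : ℕ, ((n : ℂ) + 1 / 2) ≠ 0 := natCast_add_half_ne_zero
  have hcast' : ∀ n : ℕ, 2 * ((n : ℂ) + 1) - 1 ≠ 0 := fun n h =>
    hcast n (by linear_combination h / 2)
  have hne : ∀ y : ℂ, 0 < y.re → ∀ r : ℝ, 0 < r → y + r ≠ 0 := fun y hy r hr h => by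
    have : (y + r).re = 0 := by rw [h]; simp
    simp at this
    linarith
  refine ⟨fun hx1 => ?_, fun hx1 => ?_⟩
  · have hρ : (((1 / 3 : ℝ) : ℝ) : ℂ) = 1 / 3 := by push_cast; rfl
    have hd : x ^ 2 - (((1 / 3 : ℝ) : ℝ) : ℂ) ^ 2 ≠ 0 := by
      rw [sq_sub_sq]
      exact mul_ne_zero (hne x hx _ (by norm_num)) (sub_ne_zero.2 (by rwa [hρ]))
    -- With `m = n + 1` one has `N = m - 1/2`, so `N - 1/6 = (3m - 2)/3` and `N + 1/6 = (3m - 1)/3`;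
    -- the sum of the parameters is `1/6`, whence `ρ = 1/3`.
    have h := contFractConvergesTo_of_hasSolRatio (A := upCoeff (-1 / 6) (1 / 6) (1 / 6))
      (C := downCoeff (-1 / 6) (1 / 6) (1 / 6)) (a := κ) (ρ := 1 / 3)
      (upCoeff_pos (by norm_num [abs_lt]) (by norm_num [abs_lt]) (by norm_num [abs_lt]))
      (by norm_num) hx hd ?_ ?_
      (hasSolRatio_gamma (by norm_num [abs_le]) (by norm_num [abs_le]) (by norm_num [abs_le])
        (by norm_num) (by norm_num) hx (by rwa [hρ]) ?_)
    · rw [hρ] at h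
      convert h using 2
      norm_num
    · intro n
      have := hκ_odd (n + 1) (by omega)
      rw [show 2 * (n + 1) - 1 = 2 * n + 1 by omega] at this
      rw [this, downCoeff, upCoeff]
      have h1 := hcast n
      have h2 := hcast' n
      push_cast
      rw [div_eq_div_iff (mul_ne_zero (by norm_num) h2) h1]
      ring
    · intro n
      have := hκ_even (n + 1) (by omega)
      rw [show 2 * (n + 1) = 2 * n + 2 by ring] at this
      rw [this, upCoeff]
      have h1 := hcast n
      have h2 := hcast' n
      push_cast
      rw [div_eq_div_iff (mul_ne_zero (by norm_num) h2) h1]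
      ring
    · intro y hy
      have h1 := hne y hy (1 / 3) (by norm_num)
      have h2 := hne y hy 1 (by norm_num)
      push_cast at h1 h2 ⊢
      rw [div_pow, div_eq_div_iff ?_ (pow_ne_zero _ h1)]
      · ring
      · rw [show (y + 1 / 3) * (y + 1 / 2 - -1 / 6 + 1 / 6 + 1 / 6) *
          (y + 1 / 2 + -1 / 6 - 1 / 6 + 1 / 6) * (y + 1 / 2 + -1 / 6 + 1 / 6 - 1 / 6) =
          (y + 1 / 3) ^ 3 * (y + 1) by ring]
        exact mul_ne_zero (pow_ne_zero _ h1) h2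
  · have hρ : (((1 : ℝ) : ℝ) : ℂ) = 1 := by push_cast; rfl
    have hd : x ^ 2 - (((1 : ℝ) : ℝ) : ℂ) ^ 2 ≠ 0 := by
      rw [sq_sub_sq]
      exact mul_ne_zero (hne x hx _ (by norm_num)) (sub_ne_zero.2 (by rwa [hρ]))
    -- Three equal parameters make the partial numerators cubes; their sum `-1/2` gives `ρ = 1`.
    have h := contFractConvergesTo_of_hasSolRatio (A := upCoeff (-1 / 6) (-1 / 6) (-1 / 6))
      (C := downCoeff (-1 / 6) (-1 / 6) (-1 / 6)) (a := ν) (ρ := 1)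
      (upCoeff_pos (by norm_num [abs_lt]) (by norm_num [abs_lt]) (by norm_num [abs_lt]))
      (by norm_num) hx hd ?_ ?_
      (hasSolRatio_gamma (by norm_num [abs_le]) (by norm_num [abs_le]) (by norm_num [abs_le])
        (by norm_num) (by norm_num) hx (by rwa [hρ]) ?_)
    · rw [hρ] at h
      convert h using 2
      norm_num
    · intro n
      have := hν_odd (n + 1) (by omega)
      rw [show 2 * (n + 1) - 1 = 2 * n + 1 by omega] at this
      rw [this, downCoeff, upCoeff]
      have h1 := hcast n
      have h2 := hcast' n
      push_cast
      rw [div_eq_div_iff (mul_ne_zero (by norm_num) h2) h1]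
      ring
    · intro n
      have := hν_even (n + 1) (by omega)
      rw [show 2 * (n + 1) = 2 * n + 2 by ring] at this
      rw [this, upCoeff]
      have h1 := hcast n
      have h2 := hcast' n
      push_cast
      rw [div_eq_div_iff (mul_ne_zero (by norm_num) h2) h1]
      ring
    · intro y hy
      have h1 := hne y hy (1 / 3) (by norm_num)
      have h2 := hne y hy 1 (by norm_num)
      push_cast at h1 h2 ⊢
      rw [div_pow, div_eq_div_iff ?_ (pow_ne_zero _ h1)]
      · ring
      · rw [show (y + 1) * (y + 1 / 2 - -1 / 6 + -1 / 6 + -1 / 6) *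
          (y + 1 / 2 + -1 / 6 - -1 / 6 + -1 / 6) * (y + 1 / 2 + -1 / 6 + -1 / 6 - -1 / 6) =
          (y + 1 / 3) ^ 3 * (y + 1) by ring]
        exact mul_ne_zero (pow_ne_zero _ h1) h2
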